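/- **Setting.** There are $K\ge 3$ arms, $D\ge 1$ users and a horizon $T\ge 1$. User $d$ prefers arm $i$ to arm $j$ with probability $\mathcal P_{d,i,j}\in[0,1]$, where $\mathcal P_{d,i,j}+\mathcal P_{d,j,i}=1$ and $\mathcal P_{d,i,i}=\tfrac12$. In round $t$ the agent chooses policies $\pi_t,\pi_t'$ in the probability simplex over the arms, draws $a_t\sim\pi_t$ and $a_t'\sim\pi_t'$ independently, and observes $y_t\in\{0,1\}^D$, where $y_t[d]=1$ (user $d$ prefers $a_t$ to $a'_t$) with probability $\mathcal P_{d,a_t,a_t'}$; the vectors of different rounds are drawn afresh, and within a round the entries may have any joint law with these marginals. Every user $d$ has a Condorcet winner $a_d^*$, i.e. $\mathcal P_{d,a_d^*,j}>\tfrac12$ for all $j\ne a_d^*$; let $\mathcal A^*=\{a_1^*,\dots,a_D^*\}$. The minimum preference gap $\Delta=\min_{d,\,i\neq j}|\tfrac12-\mathcal P_{d,i,j}|$ is positive. With the scores $s_d(i)=2\mathcal P_{d,i,a_d^*}$, the Nash social welfare of a policy is $\mathrm{NSW}(\pi,s)=\prod_{d=1}^D\sum_a\pi(a)s_d(a)$,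 and with $\pi^*\in\arg\max_\pi \mathrm{NSW}(\pi,s)$ the expected regret is $$\mathbb E[R_T]=\mathbb E\Big[\sum_{t=1}^T\Big(\mathrm{NSW}(\pi^*,s)-\tfrac12\big(\mathrm{NSW}(\pi_t,s)+\mathrm{NSW}(\pi_t',s)\big)\Big)\Big].$$ **Algorithm Fair-ETC** (confidence $\delta$, exploration length $L$; stopped after $T$ rounds). (1) *Tournament.* Put $\delta'=\delta/(DK)$, $S_d=\{1,\dots,K\}$ for every user $d$, and $R(i,j)=1$ for every unordered pair of arms. While some $|S_d|>1$, choose any such user $d$ and any two distinct arms $i,j\in S_d$, and repeat the following as long as $i,j\in S_d$: with $r=R(i,j)$, $h_r=2^{-(r+1)}$, $\delta_r=6\delta'/(\pi^2r^2)$, play the duel $(i,j)$ $N_r=\lceil 8\log(4/\delta_r)/h_r^2\rceil$ times (at least once); for every user $d'$ with $i,j\in S_{d'}$, if the fraction $\hat p_{d'}$ of these duels in which $d'$ preferred $i$ satisfies $|\hat p_{d'}-\tfrac12|>\tfrac12h_r$, remove $j$ from $S_{d'}$ if $\hat p_{d'}>\tfrac12$ and $i$ otherwise; increase $R(i,j)$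 by one. At the end let $\hat a_d^*$ be the remaining element of $S_d$. (2) *Exploration.* For each $b$ in the set $\{\hat a_1^*,\dots,\hat a_D^*\}$ and each arm $a$, play the duel $(a,b)$ $L$ times; let $\hat{\mathcal P}_d(a,b)$ be the fraction of these duels in which user $d$ preferred $a$. (3) *Commitment.* Choose any $\hat\pi\in\arg\max_\pi\prod_{d}\sum_a\pi(a)\,2\hat{\mathcal P}_d(a,\hat a_d^*)$ and use $\pi_t=\pi_t'=\hat\pi$ in all remaining rounds. **Theorem.** For all $c_1,c_2>0$ there is a constant $C>0$, depending only on $c_1$ and $c_2$, such that the following holds for all $K,D,T$, all instances as above, all ways of making the choices left open in the algorithm (they may depend on the past), and all $\hat\Delta\in(0,1)$. Put $g=K^{-2/3}|\mathcal A^*|^{-2/3}D^{2/3}T^{2/3}\log^{1/3}(DKT)$. If Fair-ETC is run with $\delta=\dfrac{K\log(K/2)}{2\hat\Delta T}$ and an integer $L$ with $c_1g\le L\le c_2g+1$ (that is, $L=\Theta(g)$ up to rounding), then $$\mathbb E[R_T]\le C\Big(\frac{KD}{\Delta^2}\log\frac K2\cdot\max\Big\{1,\ \log\log\frac1\Delta+\log\frac{2\hat\Delta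 T}{KD\log(K/2)}\Big\}+D^{2/3}K^{1/3}|\mathcal A^*|^{1/3}T^{2/3}\log^{1/3}(DKT)+\frac{K\log(K/2)}{\hat\Delta}\Big).$$ -/

import Mathlib

open scoped BigOperators

noncomputable section

namespace FairDuel

/-! ### The fair multi-user dueling bandit problem -/

/-- Policies: points of the probability simplex over the `K` arms. -/
abbrev Policy (K : ℕ) : Type := stdSimplex ℝ (Fin K)

/-- The policy that plays arm `i` with probability one. -/
def pureArm {K : ℕ} (i : Fin K) : Policy K := ⟨Pi.single i 1, single_mem_stdSimplex ℝ i⟩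

/-- A problem instance with `K` arms and `D` users.  `P d i j` is the probability that user `d`
prefers arm `i` to arm `j`.  `feedback i j` is the joint law of the feedback vector of the duel
`(i, j)`; only its marginals are prescribed, so the users may be correlated within a round. -/
structure Problem (K D : ℕ) where
  P : Fin D → Fin K → Fin K → ℝ
  P_mem : ∀ d i j, P d i j ∈ Set.Icc (0 : ℝ) 1
  P_add : ∀ d i j, P d i j + P d j i = 1
  P_self : ∀ d i, P d i i = 1 / 2
  feedback : Fin K → Fin K → PMF (Fin D → Bool)
  marginal : ∀ d i j,
    ∑ y : Fin D → Bool, (if y d = true then (feedback i j y).toReal else 0) = P d i j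

/-- `a` is the Condorcet winner of user `d`. -/
def Problem.IsCondorcetWinner {K D : ℕ} (I : Problem K D) (d : Fin D) (a : Fin K) : Prop :=
  ∀ j, j ≠ a → 1 / 2 < I.P d a j

/-- The scores `s_d(i) = 2 P_{d,i,a*_d}` relative to the winners `aStar`. -/
def Problem.score {K D : ℕ} (I : Problem K D) (aStar : Fin D → Fin K) (d : Fin D) (i : Fin K) : ℝ :=
  2 * I.P d i (aStar d)

/-- `Δ` is the minimum preference gap `min_{d, i ≠ j} |1/2 - P_{d,i,j}|`. -/
def Problem.IsMinGap {K D : ℕ} (I : Problem K D) (Δ : ℝ) : Prop :=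
  IsLeast {x : ℝ | ∃ (d : Fin D) (i j : Fin K), i ≠ j ∧ x = |1 / 2 - I.P d i j|} Δ

/-- Nash social welfare `∏_d E_{a ∼ π}[s_d(a)]`. -/
def nsw {K D : ℕ} (π : Policy K) (s : Fin D → Fin K → ℝ) : ℝ :=
  ∏ d, ∑ a, π.1 a * s d a

/-! ### Interaction of an algorithm with an instance -/

/-- One round: the two arms played and the feedback vector (`true`: the first arm is preferred). -/
abbrev Obs (K D : ℕ) : Type := Fin K × Fin K × (Fin D → Bool)

/-- An algorithm maps the past rounds, listed with the most recent round first, to the two policies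
of the next round. -/
abbrev Algorithm (K D : ℕ) : Type := List (Obs K D) → Policy K × Policy K

/-- The probability that the first rounds are the given ones (most recent round first): the arms of
each round are drawn independently from the two policies, the feedback from the law of the duel. -/
def trajProb {K D : ℕ} (I : Problem K D) (A : Algorithm K D) : List (Obs K D) → ℝ
  | [] => 1
  | o :: h => trajProb I A h *
      ((A h).1.1 o.1 * (A h).2.1 o.2.1 * (I.feedback o.1 o.2.1 o.2.2).toReal)

/-- The regret `∑_t (f(π*, s) - (f(π_t, s) + f(π'_t, s)) / 2)` accumulated over the given rounds. -/
def trajRegret {K D : ℕ} (s : Fin D → Fin K → ℝ) (πStar : Policy K) (A : Algorithm K D) :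
    List (Obs K D) → ℝ
  | [] => 0
  | _ :: h => trajRegret s πStar A h +
      (nsw πStar s - (nsw (A h).1 s + nsw (A h).2 s) / 2)

/-- The expected regret over `T` rounds: the sum runs over all possible lists of `T` rounds. -/
def expectedRegret {K D : ℕ} (I : Problem K D) (s : Fin D → Fin K → ℝ) (πStar : Policy K)
    (A : Algorithm K D) (T : ℕ) : ℝ :=
  ∑ ω : Fin T → Obs K D, trajProb I A (List.ofFn ω) * trajRegret s πStar A (List.ofFn ω)

/-! ### The Fair-ETC algorithm -/

/-- The steps of Fair-ETC that are left open, each resolved by an arbitrary rule that may use the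
whole past: which user with more than one candidate, and which two of its candidates, the
tournament compares next, and which maximizer of the estimated welfare is committed to. -/
structure Choices (K D : ℕ) where
  select : List (Obs K D) → (Fin D → Finset (Fin K)) → Fin D × Fin K × Fin K
  select_spec : ∀ (h : List (Obs K D)) (S : Fin D → Finset (Fin K)), (∃ d, 1 < (S d).card) →
    1 < (S (select h S).1).card ∧ (select h S).2.1 ∈ S (select h S).1 ∧
      (select h S).2.2 ∈ S (select h S).1 ∧ (select h S).2.1 ≠ (select h S).2.2
  argmax : List (Obs K D) → (Fin D → Fin K → ℝ) → Policy K
  argmax_spec : ∀ (h : List (Obs K D)) (s : Fin D → Fin K → ℝ) (π : Policy K),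
    nsw π s ≤ nsw (argmax h s) s

/-- State of the multi-user tournament inside a call of DKW-Compare: candidate sets `S_d`, round
trackers `R(i, j)` of unordered pairs, the calling user, the pair `(i, j)` being compared, and, for
the current round of that pair, the number of duels played and each user's number of votes for `i`. -/
structure TournamentState (K D : ℕ) where
  cand : Fin D → Finset (Fin K)
  round : Sym2 (Fin K) → ℕ
  caller : Fin D
  i : Fin K
  j : Fin K
  count : ℕ
  wins : Fin D → ℕ

/-- State of Fair-ETC: in the tournament; exploring (estimated winners, the current pair, the pairs
left to be played after it, and for each user `d` and pair `(a, b)` the number of exploration duels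
`(a, b)` in which `d` preferred `a`); or committed to a policy. -/
inductive State (K D : ℕ) where
  | identify (s : TournamentState K D)
  | explore (winner : Fin D → Fin K) (cur : Fin K × Fin K) (rest : List (Fin K × Fin K))
      (wins : Fin D → Fin K → Fin K → ℕ)
  | commit (π : Policy K)

/-- The width `h_r = 2^{-(r+1)}` of round `r`. -/
def width (r : ℕ) : ℝ := (1 / 2 : ℝ) ^ (r + 1)

/-- The confidence `δ_r = 6 δ' / (π² r²)` of round `r`. -/
def roundConf (δ' : ℝ) (r : ℕ) : ℝ := 6 * δ' / (Real.pi ^ 2 * (r : ℝ) ^ 2)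

/-- The number of duels `N_r = ⌈8 log(4 / δ_r) / h_r²⌉` of round `r`. -/
def numDuels (δ' : ℝ) (r : ℕ) : ℕ := ⌈8 * Real.log (4 / roundConf δ' r) / width r ^ 2⌉₊

/-- The surviving arm of a candidate set that has been reduced to one element. -/
def survivor {K : ℕ} [NeZero K] (S : Finset (Fin K)) : Fin K :=
  if h : S.Nonempty then S.min' h else 0

/-- The pairs of the exploration phase: for each arm `b` of the set of estimated winners and each
arm `a`, the pair `(a, b)` is played `L` times. -/
def schedule {K D : ℕ} (L : ℕ) (winner : Fin D → Fin K) : List (Fin K × Fin K) :=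
  ((Finset.univ.image winner).sort (· ≤ ·)).flatMap fun b =>
    (List.finRange K).flatMap fun a => List.replicate L (a, b)

/-- The estimated scores `2 P̂_d(a, â*_d)`, where `P̂` is the fraction of the `L` duels won. -/
def estScore {K D : ℕ} (L : ℕ) (winner : Fin D → Fin K) (wins : Fin D → Fin K → Fin K → ℕ)
    (d : Fin D) (a : Fin K) : ℝ :=
  2 * ((wins d a (winner d) : ℝ) / (L : ℝ))

/-- Continue the exploration with the remaining pairs, or commit if there are none. -/
def continueExplore {K D : ℕ} (c : Choices K D) (L : ℕ) (h : List (Obs K D))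
    (winner : Fin D → Fin K) (wins : Fin D → Fin K → Fin K → ℕ) :
    List (Fin K × Fin K) → State K D
  | [] => State.commit (c.argmax h (estScore L winner wins))
  | p :: ps => State.explore winner p ps wins

open Classical in
/-- Top of the tournament's main loop: call DKW-Compare for a user with more than one candidate and
two of its candidates, or start exploring if no such user is left. -/
def nextCall {K D : ℕ} [NeZero K] (c : Choices K D) (L : ℕ) (h : List (Obs K D))
    (cand : Fin D → Finset (Fin K)) (round : Sym2 (Fin K) → ℕ) : State K D :=
  if ∃ d, 1 < (cand d).card then
    State.identify
      { cand := cand, round := round, caller := (c.select h cand).1,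
        i := (c.select h cand).2.1, j := (c.select h cand).2.2, count := 0, wins := fun _ => 0 }
  else
    continueExplore c L h (fun d => survivor (cand d)) (fun _ _ _ => 0)
      (schedule L fun d => survivor (cand d))

open Classical in
/-- Elimination at the end of a round for the pair `(i, j)`, with width `w` and empirical
probabilities `phat`: every user that still has both arms, and whose empirical probability differs
from `1/2` by more than `w / 2`, drops the loser. -/
def eliminate {K D : ℕ} (cand : Fin D → Finset (Fin K)) (i j : Fin K) (w : ℝ) (phat : Fin D → ℝ) :
    Fin D → Finset (Fin K) := fun d =>
  if i ∈ cand d ∧ j ∈ cand d ∧ w / 2 < |phat d - 1 / 2| then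
    (if 1 / 2 < phat d then (cand d).erase j else (cand d).erase i)
  else cand d

open Classical in
/-- Tournament step after a duel `(i, j)` with feedback `y`; `δ'` is the confidence with which
DKW-Compare is called, and `h` the past including this duel.  The round `r = R(i, j)` goes on until
`N_r` duels have been played (at least one); then the losers are eliminated, `R(i, j)` is increased,
and the call goes on as long as the calling user still has both arms. -/
def tournamentStep {K D : ℕ} [NeZero K] (c : Choices K D) (δ' : ℝ) (L : ℕ) (h : List (Obs K D))
    (s : TournamentState K D) (y : Fin D → Bool) : State K D :=
  let r := s.round s(s.i, s.j)
  let n := s.count + 1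
  let w : Fin D → ℕ := fun d => s.wins d + if y d = true then 1 else 0
  if n < numDuels δ' r then
    State.identify { s with count := n, wins := w }
  else
    let cand' := eliminate s.cand s.i s.j (width r) (fun d => (w d : ℝ) / (n : ℝ))
    let round' := Function.update s.round s(s.i, s.j) (r + 1)
    if s.i ∈ cand' s.caller ∧ s.j ∈ cand' s.caller then
      State.identify { s with cand := cand', round := round', count := 0, wins := fun _ => 0 }
    else nextCall c L h cand' round'

/-- The state of Fair-ETC with confidence `δ` and exploration length `L` after the given rounds
(most recent round first).  The tournament has confidence `δ / D` and calls DKW-Compare with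
confidence `(δ / D) / K`. -/
def fairETCState {K D : ℕ} [NeZero K] (c : Choices K D) (δ : ℝ) (L : ℕ) :
    List (Obs K D) → State K D
  | [] => nextCall c L [] (fun _ => Finset.univ) (fun _ => 1)
  | o :: h =>
    match fairETCState c δ L h with
    | State.identify s => tournamentStep c (δ / (D : ℝ) / (K : ℝ)) L (o :: h) s o.2.2
    | State.explore winner cur rest wins =>
        continueExplore c L (o :: h) winner
          (fun d a b => wins d a b + if (a, b) = cur ∧ o.2.2 d = true then 1 else 0) rest
    | State.commit π => State.commit π

/-- The Fair-ETC algorithm: duels are played deterministically in the tournament and in the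
exploration phase; after that both arms are drawn from the committed policy. -/
def fairETC {K D : ℕ} [NeZero K] (c : Choices K D) (δ : ℝ) (L : ℕ) : Algorithm K D := fun h =>
  match fairETCState c δ L h with
  | State.identify s => (pureArm s.i, pureArm s.j)
  | State.explore _ cur _ _ => (pureArm cur.1, pureArm cur.2)
  | State.commit π => (π, π)

/-! ### The parameters of the algorithm -/

/-- The confidence parameter `δ = K log(K/2) / (2 Δ̂ T)`. -/
def confParam (K T : ℕ) (Δhat : ℝ) : ℝ := (K : ℝ) * Real.log ((K : ℝ) / 2) / (2 * Δhat * (T : ℝ))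

/-- The order `K^{-2/3} |A*|^{-2/3} D^{2/3} T^{2/3} log^{1/3}(DKT)` of the exploration length, for
`m = |A*|` distinct Condorcet winners. -/
def exploreOrder (K D T m : ℕ) : ℝ :=
  (K : ℝ) ^ (-(2 / 3) : ℝ) * (m : ℝ) ^ (-(2 / 3) : ℝ) * (D : ℝ) ^ (2 / 3 : ℝ) *
    (T : ℝ) ^ (2 / 3 : ℝ) * Real.log ((D : ℝ) * (K : ℝ) * (T : ℝ)) ^ (1 / 3 : ℝ)

end FairDuel

end

/-! ### Two-sided exponential deviation potentials -/

/-! All scores lie in [0,1], so a round costs at most 1. A run fails if some estimate, at the end of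
a tournament round or of the exploration, leaves its confidence interval. The regret is bounded
pathwise on runs without failure; a failing run costs at most T, which adds T times the failure
probability.

Failure probability. Rounds are started adaptively, so Hoeffding's inequality is used as a potential
`dev`: a supermartingale along the samples, starting at 2 exp(-2Nη²) and at least 1 at a deviation
of η. Summing over users and adding a budget for rounds not yet started gives
`failProcess_supermartingale`. Correlated users are harmless, since each summand sees one marginal.
A pair and user need only the budget δ'² (`exp_numDuels_le`), and K² · D · (δ/(DK))² = δ²/D.

Runs without failure (`trajRegret_le_of_not_failed`). A Condorcet winner is never eliminated, and
once h_r < Δ a round separates its pair for every user at once. So a pair needs about Δ⁻² duels, up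
to a logarithm. At most K² pairs are ever compared, and at most DK, because each call starts at most
one new pair and costs its caller an arm. Both counts matter: `min_mul_log_le` uses them to absorb
the log D coming from the union bound.

Commitment. A score error ε changes the welfare by O(Dε), so the estimated maximizer loses O(Dε) per
round (`nsw_sub_le_of_argmax`). With ε of order sqrt(log(DKT)/L), the total TDε balances the
exploration length |A*|KL exactly at L of order g. -/

/-- Hoeffding's lemma for a Bernoulli variable. -/
theorem bernoulli_exp_le {p : ℝ} (hp : p ∈ Set.Icc (0 : ℝ) 1) (t : ℝ) :
    p * Real.exp (t * (1 - p)) + (1 - p) * Real.exp (t * (0 - p)) ≤ Real.exp (t ^ 2 / 8) := by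
  classical
  set ν : MeasureTheory.Measure ℝ :=
    ENNReal.ofReal p • MeasureTheory.Measure.dirac 1 +
      ENNReal.ofReal (1 - p) • MeasureTheory.Measure.dirac 0 with hν
  have hp0 : 0 ≤ p := hp.1
  have hp1 : 0 ≤ 1 - p := by linarith [hp.2]
  have hint : ∀ f : ℝ → ℝ, ∫ x, f x ∂ν = p * f 1 + (1 - p) * f 0 := by
    intro f
    rw [hν, MeasureTheory.integral_add_measure, MeasureTheory.integral_smul_measure,
      MeasureTheory.integral_smul_measure, MeasureTheory.integral_dirac,
      MeasureTheory.integral_dirac, ENNReal.toReal_ofReal hp0, ENNReal.toReal_ofReal hp1]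
    · simp
    · exact (MeasureTheory.integrable_dirac (by simp)).smul_measure (by simp)
    · exact (MeasureTheory.integrable_dirac (by simp)).smul_measure (by simp)
  have hprob : MeasureTheory.IsProbabilityMeasure ν := by
    constructor
    simp only [hν, MeasureTheory.Measure.add_apply, MeasureTheory.Measure.smul_apply, smul_eq_mul,
      MeasureTheory.measure_univ, mul_one]
    rw [← ENNReal.ofReal_add hp0 hp1]
    simp
  have hmem : ∀ᵐ x ∂ν, (fun x : ℝ => x) x ∈ Set.Icc (0 : ℝ) 1 := by
    rw [hν, MeasureTheory.ae_add_measure_iff]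
    constructor
    · apply MeasureTheory.Measure.ae_smul_measure
      rw [MeasureTheory.ae_dirac_eq]; simp
    · apply MeasureTheory.Measure.ae_smul_measure
      rw [MeasureTheory.ae_dirac_eq]; simp
  have h := (ProbabilityTheory.hasSubgaussianMGF_of_mem_Icc (X := fun x : ℝ => x) (μ := ν)
    (by fun_prop) hmem).mgf_le t
  rw [ProbabilityTheory.mgf, hint, hint] at h
  norm_num at h
  norm_num
  refine h.trans (le_of_eq ?_)
  congr 1
  ring

namespace FairDuel

/-- Two-sided exponential potential controlling the event that `N` Bernoulli samples of mean `p`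
have an average deviating from `p` by at least `η`, after `n` samples with sum `w`. -/
noncomputable def dev (η p N w n : ℝ) : ℝ :=
  Real.exp (4 * η * (w - n * p) + 2 * η ^ 2 * (N - n) - 4 * η ^ 2 * N) +
    Real.exp (-(4 * η) * (w - n * p) + 2 * η ^ 2 * (N - n) - 4 * η ^ 2 * N)

theorem dev_nonneg (η p N w n : ℝ) : 0 ≤ dev η p N w n := by
  unfold dev; positivity

theorem dev_zero (η p N : ℝ) : dev η p N 0 0 = 2 * Real.exp (-2 * N * η ^ 2) := by
  have h1 : 4 * η * (0 - 0 * p) + 2 * η ^ 2 * (N - 0) - 4 * η ^ 2 * N = -2 * N * η ^ 2 := by ring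
  have h2 : -(4 * η) * (0 - 0 * p) + 2 * η ^ 2 * (N - 0) - 4 * η ^ 2 * N = -2 * N * η ^ 2 := by ring
  rw [dev, h1, h2, two_mul]

/-- With slope 4η a deviation of η over N samples contributes 4η²N, which the constant term of the
exponent cancels. -/
theorem one_le_dev {η p N w : ℝ} (hη : 0 ≤ η) (hN : 0 < N) (h : η ≤ |w / N - p|) :
    1 ≤ dev η p N w N := by
  unfold dev
  have hw : w = N * (w / N) := by field_simp
  generalize w / N = q at *
  subst hw
  rcases le_abs.1 h with h | h
  · have : 1 ≤ Real.exp (4 * η * (N * q - N * p) + 2 * η ^ 2 * (N - N) - 4 * η ^ 2 * N) := by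
      apply Real.one_le_exp
      have := mul_nonneg (mul_nonneg hη hN.le) (sub_nonneg.2 h)
      nlinarith
    have := Real.exp_pos (-(4 * η) * (N * q - N * p) + 2 * η ^ 2 * (N - N) - 4 * η ^ 2 * N)
    linarith
  · have : 1 ≤ Real.exp (-(4 * η) * (N * q - N * p) + 2 * η ^ 2 * (N - N) - 4 * η ^ 2 * N) := by
      apply Real.one_le_exp
      have := mul_nonneg (mul_nonneg hη hN.le) (sub_nonneg.2 h)
      nlinarith
    have := Real.exp_pos (4 * η * (N * q - N * p) + 2 * η ^ 2 * (N - N) - 4 * η ^ 2 * N)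
    linarith

theorem dev_step {p : ℝ} (hp : p ∈ Set.Icc (0 : ℝ) 1) (η N w n : ℝ) :
    p * dev η p N (w + 1) (n + 1) + (1 - p) * dev η p N w (n + 1) ≤ dev η p N w n := by
  -- For both slopes ±4η Hoeffding's factor is exp(t²/8) = exp(2η²), exactly what the term 2η²(N -
  -- n) releases per sample.
  have key : ∀ t : ℝ, t ^ 2 = 16 * η ^ 2 →
      p * Real.exp (t * (w + 1 - (n + 1) * p) + 2 * η ^ 2 * (N - (n + 1)) - 4 * η ^ 2 * N) +
        (1 - p) * Real.exp (t * (w - (n + 1) * p) + 2 * η ^ 2 * (N - (n + 1)) - 4 * η ^ 2 * N)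
      ≤ Real.exp (t * (w - n * p) + 2 * η ^ 2 * (N - n) - 4 * η ^ 2 * N) := by
    intro t ht
    have h := bernoulli_exp_le hp t
    set E := Real.exp (t * (w - n * p) + 2 * η ^ 2 * (N - (n + 1)) - 4 * η ^ 2 * N) with hE
    have e1 : Real.exp (t * (w + 1 - (n + 1) * p) + 2 * η ^ 2 * (N - (n + 1)) - 4 * η ^ 2 * N)
        = E * Real.exp (t * (1 - p)) := by
      rw [hE, ← Real.exp_add]; congr 1; ring
    have e2 : Real.exp (t * (w - (n + 1) * p) + 2 * η ^ 2 * (N - (n + 1)) - 4 * η ^ 2 * N)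
        = E * Real.exp (t * (0 - p)) := by
      rw [hE, ← Real.exp_add]; congr 1; ring
    have e3 : Real.exp (t * (w - n * p) + 2 * η ^ 2 * (N - n) - 4 * η ^ 2 * N)
        = E * Real.exp (t ^ 2 / 8) := by
      rw [hE, ← Real.exp_add]; congr 1; rw [ht]; ring
    rw [e1, e2, e3]
    have := mul_le_mul_of_nonneg_left h (Real.exp_pos _).le (a := E)
    linarith
  have h1 := key (4 * η) (by ring)
  have h2 := key (-(4 * η)) (by ring)
  unfold dev
  linarith

/-! ### Stability of the Nash social welfare -/

/-- Telescoping, one factor at a time. Only the `x i` are at most 1; the estimated factors may reach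
1 + ε, hence the bound (1 + ε)^n - 1 instead of nε. -/
theorem abs_prod_sub_prod_le {ι : Type*} (s : Finset ι) (x y : ι → ℝ) {ε : ℝ}
    (hx0 : ∀ i, 0 ≤ x i) (hx1 : ∀ i, x i ≤ 1) (hy0 : ∀ i, 0 ≤ y i)
    (hxy : ∀ i, |y i - x i| ≤ ε) (hε : 0 ≤ ε) :
    |∏ i ∈ s, y i - ∏ i ∈ s, x i| ≤ (1 + ε) ^ s.card - 1 := by
  classical
  induction s using Finset.induction_on with
  | empty => simp
  | insert a s ha ih =>
    rw [Finset.prod_insert ha, Finset.prod_insert ha, Finset.card_insert_of_notMem ha]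
    have e : y a * ∏ i ∈ s, y i - x a * ∏ i ∈ s, x i =
        y a * (∏ i ∈ s, y i - ∏ i ∈ s, x i) + (y a - x a) * ∏ i ∈ s, x i := by ring
    have hy : y a ≤ 1 + ε := by linarith [(abs_le.1 (hxy a)).2, hx1 a]
    have hP0 : 0 ≤ ∏ i ∈ s, x i := Finset.prod_nonneg fun i _ => hx0 i
    have hP1 : ∏ i ∈ s, x i ≤ 1 := Finset.prod_le_one (fun i _ => hx0 i) fun i _ => hx1 i
    calc |y a * ∏ i ∈ s, y i - x a * ∏ i ∈ s, x i|
        ≤ |y a * (∏ i ∈ s, y i - ∏ i ∈ s, x i)| + |(y a - x a) * ∏ i ∈ s, x i| := by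
          rw [e]; exact abs_add_le _ _
      _ = y a * |∏ i ∈ s, y i - ∏ i ∈ s, x i| + |y a - x a| * ∏ i ∈ s, x i := by
          rw [abs_mul, abs_mul, abs_of_nonneg (hy0 a), abs_of_nonneg hP0]
      _ ≤ (1 + ε) * ((1 + ε) ^ s.card - 1) + ε * 1 := by
          have := hxy a
          gcongr
      _ = (1 + ε) ^ (s.card + 1) - 1 := by ring

theorem one_add_pow_sub_one_le (D : ℕ) {ε : ℝ} (hε : 0 ≤ ε) (h : D * ε ≤ 1) :
    (1 + ε) ^ D - 1 ≤ 2 * (D * ε) := by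
  have h1 : (1 + ε) ^ D ≤ Real.exp (D * ε) := by
    rw [Real.exp_nat_mul]
    gcongr
    linarith [Real.add_one_le_exp ε]
  have h0 : 0 ≤ D * ε := by positivity
  have h2 := Real.abs_exp_sub_one_le (x := D * ε) (by rw [abs_of_nonneg h0]; exact h)
  rw [abs_of_nonneg h0] at h2
  linarith [le_abs_self (Real.exp (D * ε) - 1)]

theorem policy_nonneg {K : ℕ} (π : Policy K) (a : Fin K) : 0 ≤ π.1 a := π.2.1 a

theorem policy_sum {K : ℕ} (π : Policy K) : ∑ a, π.1 a = 1 := π.2.2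

theorem nsw_nonneg {K D : ℕ} (π : Policy K) {s : Fin D → Fin K → ℝ} (hs : ∀ d a, 0 ≤ s d a) :
    0 ≤ nsw π s :=
  Finset.prod_nonneg fun d _ =>
    Finset.sum_nonneg fun a _ => mul_nonneg (policy_nonneg π a) (hs d a)

theorem policy_avg_le {K : ℕ} (π : Policy K) {f : Fin K → ℝ} {c : ℝ} (hf : ∀ a, f a ≤ c) :
    ∑ a, π.1 a * f a ≤ c := by
  calc ∑ a, π.1 a * f a ≤ ∑ a, π.1 a * c :=
        Finset.sum_le_sum fun a _ => mul_le_mul_of_nonneg_left (hf a) (policy_nonneg π a)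
    _ = c := by rw [← Finset.sum_mul, policy_sum, one_mul]

theorem nsw_le_one {K D : ℕ} (π : Policy K) {s : Fin D → Fin K → ℝ} (hs : ∀ d a, 0 ≤ s d a)
    (hs1 : ∀ d a, s d a ≤ 1) : nsw π s ≤ 1 :=
  Finset.prod_le_one
    (fun d _ => Finset.sum_nonneg fun a _ => mul_nonneg (policy_nonneg π a) (hs d a))
    fun d _ => policy_avg_le π (hs1 d)

theorem abs_nsw_sub_le {K D : ℕ} (π : Policy K) {s s' : Fin D → Fin K → ℝ} {ε : ℝ}
    (hs : ∀ d a, 0 ≤ s d a) (hs1 : ∀ d a, s d a ≤ 1) (hs' : ∀ d a, 0 ≤ s' d a)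
    (h : ∀ d a, |s' d a - s d a| ≤ ε) (hε : 0 ≤ ε) (hD : D * ε ≤ 1) :
    |nsw π s' - nsw π s| ≤ 2 * (D * ε) := by
  refine le_trans ?_ (one_add_pow_sub_one_le D hε hD)
  have := abs_prod_sub_prod_le (Finset.univ : Finset (Fin D)) (fun d => ∑ a, π.1 a * s d a)
    (fun d => ∑ a, π.1 a * s' d a) (ε := ε)
    (fun d => Finset.sum_nonneg fun a _ => mul_nonneg (policy_nonneg π a) (hs d a))
    (fun d => policy_avg_le π (hs1 d))
    (fun d => Finset.sum_nonneg fun a _ => mul_nonneg (policy_nonneg π a) (hs' d a))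
    (fun d => ?_) hε
  · simpa [nsw] using this
  · rw [← Finset.sum_sub_distrib]
    calc |∑ a, (π.1 a * s' d a - π.1 a * s d a)|
        ≤ ∑ a, |π.1 a * s' d a - π.1 a * s d a| := Finset.abs_sum_le_sum_abs _ _
      _ = ∑ a, π.1 a * |s' d a - s d a| := by
          refine Finset.sum_congr rfl fun a _ => ?_
          rw [← mul_sub, abs_mul, abs_of_nonneg (policy_nonneg π a)]
      _ ≤ ε := policy_avg_le π (h d)

/-- Maximizing an estimated welfare is nearly optimal for the true one. -/
theorem nsw_sub_le_of_argmax {K D : ℕ} {πStar π : Policy K} {s s' : Fin D → Fin K → ℝ} {ε : ℝ}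
    (hs : ∀ d a, 0 ≤ s d a) (hs1 : ∀ d a, s d a ≤ 1) (hs' : ∀ d a, 0 ≤ s' d a)
    (h : ∀ d a, |s' d a - s d a| ≤ ε) (hε : 0 ≤ ε) (hπ : nsw πStar s' ≤ nsw π s') :
    nsw πStar s - nsw π s ≤ 4 * (D * ε) := by
  -- If Dε > 1 the claimed bound exceeds 1, the largest possible welfare.
  by_cases hD : D * ε ≤ 1
  · have h1 := abs_le.1 (abs_nsw_sub_le πStar hs hs1 hs' h hε hD)
    have h2 := abs_le.1 (abs_nsw_sub_le π hs hs1 hs' h hε hD)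
    linarith
  · have h1 := nsw_le_one πStar hs hs1
    have h2 := nsw_nonneg π hs
    linarith

/-! ### Expectations over trajectories -/

section Trajectories

variable {K D : ℕ}

/-- The conditional probability that the next round is `o`, given the past `h`. -/
noncomputable def stepProb (I : Problem K D) (A : Algorithm K D) (h : List (Obs K D))
    (o : Obs K D) : ℝ :=
  (A h).1.1 o.1 * (A h).2.1 o.2.1 * (I.feedback o.1 o.2.1 o.2.2).toReal

theorem stepProb_nonneg (I : Problem K D) (A : Algorithm K D) (h : List (Obs K D)) (o : Obs K D) :
    0 ≤ stepProb I A h o :=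
  mul_nonneg (mul_nonneg (policy_nonneg _ _) (policy_nonneg _ _)) ENNReal.toReal_nonneg

theorem feedback_sum (I : Problem K D) (i j : Fin K) :
    ∑ y, (I.feedback i j y).toReal = 1 := by
  rw [← ENNReal.toReal_sum fun y _ => (I.feedback i j).apply_ne_top y]
  have := (I.feedback i j).tsum_coe
  rw [tsum_fintype] at this
  rw [this]; rfl

theorem stepProb_sum (I : Problem K D) (A : Algorithm K D) (h : List (Obs K D)) :
    ∑ o, stepProb I A h o = 1 := by
  unfold stepProb
  rw [Fintype.sum_prod_type]
  simp_rw [Fintype.sum_prod_type, ← Finset.mul_sum, feedback_sum, mul_one, ← Finset.mul_sum,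
    policy_sum, mul_one, policy_sum]

theorem sum_stepProb_pureArm (I : Problem K D) (A : Algorithm K D) (h : List (Obs K D))
    {i j : Fin K} (hA : A h = (pureArm i, pureArm j)) (G : (Fin D → Bool) → ℝ) :
    ∑ o, stepProb I A h o * G o.2.2 = ∑ y, (I.feedback i j y).toReal * G y := by
  unfold stepProb
  rw [hA, Fintype.sum_prod_type, Finset.sum_eq_single i]
  · rw [Fintype.sum_prod_type, Finset.sum_eq_single j]
    · simp [pureArm]
    · intro b _ hb
      simp [pureArm, hb]
    · simp
  · intro b _ hb
    simp [pureArm, hb]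
  · simp

/-- A function of a single user's vote only feels the prescribed marginal; this is why the joint law
within a round may be arbitrary. -/
theorem sum_feedback_ite (I : Problem K D) (d : Fin D) (i j : Fin K) (a b : ℝ) :
    ∑ y, (I.feedback i j y).toReal * (if y d = true then a else b) =
      I.P d i j * a + (1 - I.P d i j) * b := by
  have h1 := I.marginal d i j
  have h2 := feedback_sum I i j
  calc ∑ y, (I.feedback i j y).toReal * (if y d = true then a else b)
      = ∑ y, ((if y d = true then (I.feedback i j y).toReal else 0) * (a - b) +
          (I.feedback i j y).toReal * b) := by
        refine Finset.sum_congr rfl fun y _ => ?_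
        split_ifs <;> ring
    _ = _ := by
        rw [Finset.sum_add_distrib, ← Finset.sum_mul, ← Finset.sum_mul, h1, h2]; ring

theorem sum_ofFn_succ {α : Type*} [Fintype α] (n : ℕ) (f : List α → ℝ) :
    ∑ ω : Fin (n + 1) → α, f (List.ofFn ω) =
      ∑ ω : Fin n → α, ∑ o : α, f (o :: List.ofFn ω) := by
  rw [← Equiv.sum_comp (Fin.consEquiv fun _ : Fin (n + 1) => α), Fintype.sum_prod_type,
    Finset.sum_comm]
  simp [Fin.consEquiv, List.ofFn_succ]

theorem trajProb_nonneg (I : Problem K D) (A : Algorithm K D) :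
    ∀ h : List (Obs K D), 0 ≤ trajProb I A h
  | [] => zero_le_one
  | o :: h => mul_nonneg (trajProb_nonneg I A h) (stepProb_nonneg I A h o)

/-- The expectation of a nonnegative supermartingale does not exceed its initial value. -/
theorem expectation_le_of_supermartingale (I : Problem K D) (A : Algorithm K D)
    (F : List (Obs K D) → ℝ) (hF : ∀ h, ∑ o, stepProb I A h o * F (o :: h) ≤ F h) (n : ℕ) :
    ∑ ω : Fin n → Obs K D, trajProb I A (List.ofFn ω) * F (List.ofFn ω) ≤ F [] := by
  induction n with
  | zero => simp [trajProb]
  | succ n ih =>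
    rw [sum_ofFn_succ n fun h => trajProb I A h * F h]
    refine le_trans (Finset.sum_le_sum fun ω _ => ?_) ih
    calc ∑ o, trajProb I A (o :: List.ofFn ω) * F (o :: List.ofFn ω)
        = trajProb I A (List.ofFn ω) *
            ∑ o, stepProb I A (List.ofFn ω) o * F (o :: List.ofFn ω) := by
          rw [Finset.mul_sum]
          refine Finset.sum_congr rfl fun o _ => ?_
          simp only [trajProb, stepProb]; ring
      _ ≤ _ := mul_le_mul_of_nonneg_left (hF _) (trajProb_nonneg I A _)

/-- A pathwise bound on the regret by a constant plus a multiple of a supermartingale bounds the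
expected regret. -/
theorem expectedRegret_le (I : Problem K D) (A : Algorithm K D) (s : Fin D → Fin K → ℝ)
    (πStar : Policy K) (T : ℕ) (F : List (Obs K D) → ℝ)
    (hF : ∀ h, ∑ o, stepProb I A h o * F (o :: h) ≤ F h) {a b : ℝ} (ha : 0 ≤ a) (hb : 0 ≤ b)
    (hR : ∀ h : List (Obs K D), h.length = T → trajRegret s πStar A h ≤ a + b * F h) :
    expectedRegret I s πStar A T ≤ a + b * F [] := by
  have h1 := expectation_le_of_supermartingale I A (fun _ => 1)
    (fun h => by simp [stepProb_sum]) T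
  have h2 := expectation_le_of_supermartingale I A F hF T
  calc expectedRegret I s πStar A T
      ≤ ∑ ω : Fin T → Obs K D, trajProb I A (List.ofFn ω) * (a + b * F (List.ofFn ω)) :=
        Finset.sum_le_sum fun ω _ =>
          mul_le_mul_of_nonneg_left (hR _ (by simp)) (trajProb_nonneg I A _)
    _ = a * ∑ ω : Fin T → Obs K D, trajProb I A (List.ofFn ω) * 1 +
          b * ∑ ω : Fin T → Obs K D, trajProb I A (List.ofFn ω) * F (List.ofFn ω) := by
        rw [Finset.mul_sum, Finset.mul_sum, ← Finset.sum_add_distrib]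
        exact Finset.sum_congr rfl fun ω _ => by ring
    _ ≤ a * 1 + b * F [] := by gcongr
    _ = _ := by ring

end Trajectories

/-! ### Confidence budget of the tournament -/

theorem width_pos (r : ℕ) : 0 < width r := by unfold width; positivity

theorem roundConf_pos {δ' : ℝ} (h : 0 < δ') {r : ℕ} (hr : 1 ≤ r) : 0 < roundConf δ' r := by
  have : (0 : ℝ) < r := by exact_mod_cast hr
  unfold roundConf; positivity

theorem roundConf_le {δ' : ℝ} (h : 0 < δ') {r : ℕ} (hr : 1 ≤ r) :
    roundConf δ' r ≤ δ' / (r : ℝ) ^ 2 := by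
  have : (0 : ℝ) < r := by exact_mod_cast hr
  unfold roundConf
  have hpi : (6 : ℝ) ≤ Real.pi ^ 2 := by nlinarith [Real.pi_gt_three]
  rw [div_le_div_iff₀ (by positivity) (by positivity)]
  have : 0 ≤ δ' * (r : ℝ) ^ 2 := by positivity
  nlinarith

theorem roundConf_le_one {δ' : ℝ} (h : 0 < δ') (h1 : δ' ≤ 1) {r : ℕ} (hr : 1 ≤ r) :
    roundConf δ' r ≤ 1 := by
  refine (roundConf_le h hr).trans ((div_le_one₀ ?_).2 ?_)
  · have : (0 : ℝ) < r := by exact_mod_cast hr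
    positivity
  · have : (1 : ℝ) ≤ r := by exact_mod_cast hr
    nlinarith

theorem numDuels_pos {δ' : ℝ} (h : 0 < δ') (h1 : δ' ≤ 1) {r : ℕ} (hr : 1 ≤ r) :
    0 < numDuels δ' r := by
  unfold numDuels
  rw [Nat.ceil_pos]
  have h2 := roundConf_pos h hr
  have h3 := roundConf_le_one h h1 hr
  have : 0 < Real.log (4 / roundConf δ' r) := Real.log_pos (by rw [lt_div_iff₀ h2]; linarith)
  have := width_pos r
  positivity

/-- The failure probability of round `r` telescopes into the budget `δ' ^ 2 / r`. -/
theorem exp_numDuels_le {δ' : ℝ} (h : 0 < δ') (h1 : δ' ≤ 1) {r : ℕ} (hr : 1 ≤ r) :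
    2 * Real.exp (-2 * (numDuels δ' r : ℝ) * (width r / 2) ^ 2) + δ' ^ 2 / ((r + 1 : ℕ) : ℝ) ≤
      δ' ^ 2 / (r : ℝ) := by
  have hc := roundConf_pos h hr
  have hc1 := roundConf_le_one h h1 hr
  have hcl := roundConf_le h hr
  have hw := width_pos r
  have hr' : (1 : ℝ) ≤ r := by exact_mod_cast hr
  have hN : 8 * Real.log (4 / roundConf δ' r) / width r ^ 2 ≤ (numDuels δ' r : ℝ) := Nat.le_ceil _
  rw [div_le_iff₀ (by positivity)] at hN
  -- Since N h² ≥ 8 log(4/δ_r), the exponent 2N(h/2)² = N h²/2 is at least 4 log(4/δ_r).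
  have hexp : Real.exp (-2 * (numDuels δ' r : ℝ) * (width r / 2) ^ 2) ≤
      (roundConf δ' r / 4) ^ 4 := by
    calc Real.exp (-2 * (numDuels δ' r : ℝ) * (width r / 2) ^ 2)
        ≤ Real.exp (4 * Real.log (roundConf δ' r / 4)) := by
          apply Real.exp_le_exp.2
          have : Real.log (4 / roundConf δ' r) = -Real.log (roundConf δ' r / 4) := by
            rw [← Real.log_inv, inv_div]
          rw [this] at hN
          nlinarith
      _ = (roundConf δ' r / 4) ^ 4 := by
          rw [show (4 : ℝ) * Real.log (roundConf δ' r / 4) =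
            (4 : ℕ) * Real.log (roundConf δ' r / 4) by norm_num, Real.exp_nat_mul,
            Real.exp_log (by positivity)]
  -- Of the fourth power a square of δ' is kept: a budget linear in δ' would sum to Kδ over all
  -- pairs and users. The decay 1/r² is what telescopes.
  have h4 : (roundConf δ' r / 4) ^ 4 ≤ δ' ^ 2 / (r : ℝ) ^ 2 / 256 := by
    have hsq : roundConf δ' r ^ 4 ≤ roundConf δ' r ^ 2 := pow_le_pow_of_le_one hc.le hc1 (by norm_num)
    have hsq2 : roundConf δ' r ^ 2 ≤ (δ' / (r : ℝ) ^ 2) ^ 2 := by gcongr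
    have hsq3 : (δ' / (r : ℝ) ^ 2) ^ 2 ≤ δ' ^ 2 / (r : ℝ) ^ 2 := by
      rw [div_pow]
      gcongr
      nlinarith
    calc (roundConf δ' r / 4) ^ 4 = roundConf δ' r ^ 4 / 256 := by ring
      _ ≤ _ := by linarith
  have h5 : δ' ^ 2 / (r : ℝ) - δ' ^ 2 / ((r + 1 : ℕ) : ℝ) = δ' ^ 2 / (r * (r + 1)) := by
    push_cast
    field_simp
    ring
  have h6 : δ' ^ 2 / (r : ℝ) ^ 2 / 128 ≤ δ' ^ 2 / (r * (r + 1)) := by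
    rw [div_div]
    apply div_le_div_of_nonneg_left (by positivity) (by positivity)
    nlinarith
  linarith

theorem card_sym2_le {K : ℕ} : Fintype.card (Sym2 (Fin K)) ≤ K * K := by
  have := Fintype.card_le_of_surjective _ (Sym2.mk_surjective (α := Fin K))
  simpa using this

section Analysis

variable {K D : ℕ} (I : Problem K D) (c : Choices K D) (δ' δ η : ℝ) (L : ℕ)

/-! ### Estimation failures and the failure potential -/

/-- A round of a comparison, or the exploration, ends after feedback `y` with an estimate outside
its confidence interval. -/
def failStep : State K D → (Fin D → Bool) → Prop
  | State.identify s, y =>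
      ¬ s.count + 1 < numDuels δ' (s.round s(s.i, s.j)) ∧
        ∃ d, width (s.round s(s.i, s.j)) / 2 <
          |((s.wins d + if y d = true then 1 else 0 : ℕ) : ℝ) / ((s.count + 1 : ℕ) : ℝ) -
            I.P d s.i s.j|
  | State.explore winner cur rest wins, y =>
      rest = [] ∧ ∃ d a, η <
        |((wins d a (winner d) + if (a, winner d) = cur ∧ y d = true then 1 else 0 : ℕ) : ℝ) /
          (L : ℝ) - I.P d a (winner d)|
  | State.commit _, _ => False

/-- Budget for the failure probability of the exploration when the pairs in `l` are left to play. -/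
noncomputable def exploreDev (winner : Fin D → Fin K) (w : Fin D → Fin K → Fin K → ℕ)
    (l : List (Fin K × Fin K)) : ℝ :=
  ∑ d, ∑ a, dev η (I.P d a (winner d)) L (w d a (winner d))
    ((L : ℝ) - (l.count (a, winner d) : ℝ))

/-- Upper bound for the probability that the exploration fails, before it starts. -/
noncomputable def exploreFail (K D L : ℕ) (η : ℝ) : ℝ :=
  (D : ℝ) * ((K : ℝ) * (2 * Real.exp (-2 * (L : ℝ) * η ^ 2)))

/-- Budget for the failure probability of the rounds of the tournament that are yet to start. -/
noncomputable def roundBudget (D : ℕ) (δ' : ℝ) (round : Sym2 (Fin K) → ℕ) : ℝ :=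
  ∑ p, (D : ℝ) * (δ' ^ 2 / (round p : ℝ))

/-- Budget for the failure probability of a running round with `n` duels and `w d` wins. -/
noncomputable def compareDev (i j : Fin K) (r n : ℕ) (w : Fin D → ℕ) : ℝ :=
  ∑ d, dev (width r / 2) (I.P d i j) (numDuels δ' r) (w d) n

/-- The potential that bounds the probability of a failure in the future. -/
noncomputable def failPotential : State K D → ℝ
  | State.identify s =>
      compareDev I δ' s.i s.j (s.round s(s.i, s.j)) s.count s.wins +
        roundBudget D δ' (Function.update s.round s(s.i, s.j) (s.round s(s.i, s.j) + 1)) +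
        exploreFail K D L η
  | State.explore winner cur rest wins => exploreDev I η L winner wins (cur :: rest)
  | State.commit _ => 0

theorem exploreFail_nonneg : 0 ≤ exploreFail K D L η := by unfold exploreFail; positivity

theorem roundBudget_nonneg (round : Sym2 (Fin K) → ℕ) : 0 ≤ roundBudget D δ' round := by
  unfold roundBudget; positivity

theorem compareDev_nonneg (i j : Fin K) (r n : ℕ) (w : Fin D → ℕ) :
    0 ≤ compareDev I δ' i j r n w :=
  Finset.sum_nonneg fun _ _ => dev_nonneg _ _ _ _ _

theorem exploreDev_nonneg (winner : Fin D → Fin K) (w : Fin D → Fin K → Fin K → ℕ)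
    (l : List (Fin K × Fin K)) : 0 ≤ exploreDev I η L winner w l :=
  Finset.sum_nonneg fun _ _ => Finset.sum_nonneg fun _ _ => dev_nonneg _ _ _ _ _

theorem failPotential_nonneg (s : State K D) : 0 ≤ failPotential I δ' η L s := by
  cases s with
  | identify s =>
    have h1 := compareDev_nonneg I δ' s.i s.j (s.round s(s.i, s.j)) s.count s.wins
    have h2 := roundBudget_nonneg (D := D) δ'
      (Function.update s.round s(s.i, s.j) (s.round s(s.i, s.j) + 1))
    have h3 := exploreFail_nonneg (K := K) (D := D) η L
    simp only [failPotential]; linarith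
  | explore winner cur rest wins => exact exploreDev_nonneg _ _ _ _ _ _
  | commit π => exact le_rfl

/-- The winners are scheduled as a set, so users sharing a winner share its L duels, and every
estimate that is used rests on exactly L samples. -/
theorem count_schedule (winner : Fin D → Fin K) (a : Fin K) (d : Fin D) :
    (schedule L winner).count (a, winner d) = L := by
  have inner : ∀ b : Fin K, ((List.finRange K).flatMap fun a' => List.replicate L (a', b)).count
      (a, winner d) = if b = winner d then L else 0 := by
    intro b
    rw [List.count_flatMap]
    have : (List.count (a, winner d) ∘ fun a' => List.replicate L (a', b)) =
        fun a' => if a' = a then (if b = winner d then L else 0) else 0 := by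
      funext a'
      simp only [Function.comp, List.count_replicate, beq_iff_eq, Prod.mk.injEq]
      split_ifs <;> simp_all
    rw [this, ← List.sum_toFinset _ (List.nodup_finRange K)]
    simp
  unfold schedule
  rw [List.count_flatMap]
  have : (List.count (a, winner d) ∘ fun b => (List.finRange K).flatMap fun a' =>
      List.replicate L (a', b)) = fun b => if b = winner d then L else 0 := funext inner
  rw [this, ← List.sum_toFinset _ (Finset.sort_nodup _ _)]
  simp

theorem length_schedule (winner : Fin D → Fin K) :
    (schedule L winner).length = (Finset.univ.image winner).card * (K * L) := by
  unfold schedule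
  simp [List.length_flatMap]

theorem exploreDev_schedule (winner : Fin D → Fin K) :
    exploreDev I η L winner (fun _ _ _ => 0) (schedule L winner) = exploreFail K D L η := by
  unfold exploreDev exploreFail
  simp only [count_schedule, sub_self, Nat.cast_zero, dev_zero]
  simp

theorem failPotential_continueExplore_le (h : List (Obs K D)) (winner : Fin D → Fin K)
    (w : Fin D → Fin K → Fin K → ℕ) (l : List (Fin K × Fin K)) :
    failPotential I δ' η L (continueExplore c L h winner w l) ≤ exploreDev I η L winner w l := by
  cases l with
  | nil => exact exploreDev_nonneg _ _ _ _ _ _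
  | cons p ps => exact le_rfl

/-- Starting a new round of a comparison is paid for by the round budget. -/
theorem compareDev_start_le {δ' : ℝ} (h : 0 < δ') (h1 : δ' ≤ 1) (i j : Fin K)
    (round : Sym2 (Fin K) → ℕ) (hr : ∀ p, 1 ≤ round p) :
    compareDev I δ' i j (round s(i, j)) 0 (fun _ => 0) +
      roundBudget D δ' (Function.update round s(i, j) (round s(i, j) + 1)) ≤
      roundBudget D δ' round := by
  classical
  unfold compareDev roundBudget
  rw [← Finset.add_sum_erase _ _ (Finset.mem_univ s(i, j)),
    ← Finset.add_sum_erase (a := s(i, j)) (f := fun p => (D : ℝ) * (δ' ^ 2 / (round p : ℝ))) _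
      (Finset.mem_univ s(i, j)), ← add_assoc]
  apply add_le_add
  · simp only [Nat.cast_zero, dev_zero, Finset.sum_const, Finset.card_univ, Fintype.card_fin,
      nsmul_eq_mul, Function.update_self]
    rw [← mul_add]
    exact mul_le_mul_of_nonneg_left (exp_numDuels_le h h1 (hr _)) (by positivity)
  · refine Finset.sum_le_sum fun p hp => ?_
    rw [Function.update_of_ne (Finset.ne_of_mem_erase hp)]

/-- Every reachable tournament state has positive round trackers and an unfinished round. -/
def Regular (δ' : ℝ) : State K D → Prop
  | State.identify s =>
      (∀ p, 1 ≤ s.round p) ∧ s.count < numDuels δ' (s.round s(s.i, s.j))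
  | _ => True

theorem regular_continueExplore (h : List (Obs K D)) (winner : Fin D → Fin K)
    (w : Fin D → Fin K → Fin K → ℕ) (l : List (Fin K × Fin K)) :
    Regular δ' (continueExplore c L h winner w l) := by
  cases l <;> trivial

theorem one_le_update {round : Sym2 (Fin K) → ℕ} (hr : ∀ p, 1 ≤ round p) (q : Sym2 (Fin K))
    (p : Sym2 (Fin K)) : 1 ≤ Function.update round q (round q + 1) p := by
  rw [Function.update_apply]
  split_ifs
  · omega
  · exact hr p

theorem compareDev_step_le (i j : Fin K) (r n : ℕ) (w : Fin D → ℕ) :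
    ∑ y, (I.feedback i j y).toReal *
        compareDev I δ' i j r (n + 1) (fun d => w d + if y d = true then 1 else 0) ≤
      compareDev I δ' i j r n w := by
  unfold compareDev
  simp_rw [Finset.mul_sum]
  rw [Finset.sum_comm]
  refine Finset.sum_le_sum fun d _ => ?_
  have := dev_step (I.P_mem d i j) (width r / 2) (numDuels δ' r) (w d) n
  rw [← sum_feedback_ite I d i j] at this
  refine le_trans (le_of_eq ?_) this
  refine Finset.sum_congr rfl fun y _ => ?_
  split_ifs <;> push_cast <;> simp

theorem exploreDev_step_le (winner : Fin D → Fin K) (w : Fin D → Fin K → Fin K → ℕ)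
    (cur : Fin K × Fin K) (rest : List (Fin K × Fin K)) :
    ∑ y, (I.feedback cur.1 cur.2 y).toReal *
        exploreDev I η L winner
          (fun d a b => w d a b + if (a, b) = cur ∧ y d = true then 1 else 0) rest ≤
      exploreDev I η L winner w (cur :: rest) := by
  unfold exploreDev
  simp_rw [Finset.mul_sum]
  rw [Finset.sum_comm]
  refine Finset.sum_le_sum fun d _ => ?_
  rw [Finset.sum_comm]
  refine Finset.sum_le_sum fun a _ => ?_
  -- A duel advances the potentials of the pair being played, for all users with that winner; every
  -- other potential is unchanged.
  by_cases hcur : (a, winner d) = cur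
  · subst hcur
    have := dev_step (I.P_mem d a (winner d)) η L (w d a (winner d))
      ((L : ℝ) - ((((a, winner d) :: rest).count (a, winner d) : ℕ) : ℝ))
    rw [← sum_feedback_ite I d a (winner d)] at this
    refine le_trans (le_of_eq ?_) this
    refine Finset.sum_congr rfl fun y _ => ?_
    rw [List.count_cons_self]
    have e : (L : ℝ) - ((rest.count (a, winner d) + 1 : ℕ) : ℝ) + 1 =
        (L : ℝ) - (rest.count (a, winner d) : ℝ) := by push_cast; ring
    rw [e]
    by_cases hy : y d = true <;> simp [hy]
  · rw [List.count_cons_of_ne (Ne.symm hcur)]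
    simp only [hcur, false_and, if_false, Nat.add_zero]
    rw [← Finset.sum_mul, feedback_sum, one_mul]

/-! ### The failure process of Fair-ETC is a supermartingale -/

variable [NeZero K]

/-- Some estimate of the past has been outside its confidence interval. -/
def Failed : List (Obs K D) → Prop
  | [] => False
  | o :: h => Failed h ∨ failStep I (δ / (D : ℝ) / (K : ℝ)) η L (fairETCState c δ L h) o.2.2

theorem failPotential_nextCall_le {δ' : ℝ} (h : 0 < δ') (h1 : δ' ≤ 1) (hist : List (Obs K D))
    (cand : Fin D → Finset (Fin K)) (round : Sym2 (Fin K) → ℕ) (hr : ∀ p, 1 ≤ round p) :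
    failPotential I δ' η L (nextCall c L hist cand round) ≤
      roundBudget D δ' round + exploreFail K D L η := by
  unfold nextCall
  split_ifs with hc
  · simp only [failPotential]
    have := compareDev_start_le I h h1 (c.select hist cand).2.1 (c.select hist cand).2.2 round hr
    linarith
  · refine (failPotential_continueExplore_le I c δ' η L _ _ _ _).trans ?_
    rw [exploreDev_schedule]
    linarith [roundBudget_nonneg (D := D) δ' round]

theorem regular_nextCall {δ' : ℝ} (h : 0 < δ') (h1 : δ' ≤ 1) (hist : List (Obs K D))
    (cand : Fin D → Finset (Fin K)) (round : Sym2 (Fin K) → ℕ) (hr : ∀ p, 1 ≤ round p) :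
    Regular δ' (nextCall c L hist cand round) := by
  unfold nextCall
  split_ifs with hc
  · exact ⟨hr, numDuels_pos h h1 (hr _)⟩
  · exact regular_continueExplore _ _ _ _ _ _ _

theorem regular_tournamentStep {δ' : ℝ} (h : 0 < δ') (h1 : δ' ≤ 1) (hist : List (Obs K D))
    (s : TournamentState K D) (y : Fin D → Bool) (hs : Regular δ' (State.identify s)) :
    Regular δ' (tournamentStep c δ' L hist s y) := by
  unfold tournamentStep
  dsimp only
  split_ifs with hn hc
  · exact ⟨hs.1, hn⟩
  · exact ⟨one_le_update hs.1 _, numDuels_pos h h1 (one_le_update hs.1 _ _)⟩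
  · exact regular_nextCall _ _ h h1 _ _ _ (one_le_update hs.1 _)

theorem regular_fairETCState (h : 0 < δ / (D : ℝ) / (K : ℝ)) (h1 : δ / (D : ℝ) / (K : ℝ) ≤ 1)
    (hist : List (Obs K D)) : Regular (δ / (D : ℝ) / (K : ℝ)) (fairETCState c δ L hist) := by
  induction hist with
  | nil => exact regular_nextCall _ _ h h1 _ _ _ fun _ => le_rfl
  | cons o hist ih =>
    unfold fairETCState
    split
    · rename_i s hs
      rw [hs] at ih
      exact regular_tournamentStep _ _ h h1 _ _ _ ih
    · exact regular_continueExplore _ _ _ _ _ _ _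
    · trivial

open Classical in
/-- Indicator of a past failure, plus the failure potential as long as there is none. -/
noncomputable def failProcess (h : List (Obs K D)) : ℝ :=
  if Failed I c δ η L h then 1
  else failPotential I (δ / (D : ℝ) / (K : ℝ)) η L (fairETCState c δ L h)

theorem failProcess_nonneg (h : List (Obs K D)) : 0 ≤ failProcess I c δ η L h := by
  unfold failProcess
  split_ifs
  · exact zero_le_one
  · exact failPotential_nonneg _ _ _ _ _

/-- After each duel the process is dominated, failure or not, by the advanced deviation potentials
plus the untouched budgets: at a failure one potential is at least 1, and otherwise a new round is
paid for by the budget. The dominating quantity does not increase in expectation. -/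
theorem failProcess_supermartingale (hδ : 0 < δ / (D : ℝ) / (K : ℝ))
    (hδ1 : δ / (D : ℝ) / (K : ℝ) ≤ 1) (hη : 0 ≤ η) (hL : 0 < L) (h : List (Obs K D)) :
    ∑ o, stepProb I (fairETC c δ L) h o * failProcess I c δ η L (o :: h) ≤
      failProcess I c δ η L h := by
  by_cases hf : Failed I c δ η L h
  · have h1 : ∀ o, failProcess I c δ η L (o :: h) = 1 := fun o => if_pos (Or.inl hf)
    rw [show failProcess I c δ η L h = 1 from if_pos hf]
    simp [h1, stepProb_sum]
  have hh : failProcess I c δ η L h =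
    failPotential I (δ / (D : ℝ) / (K : ℝ)) η L (fairETCState c δ L h) := if_neg hf
  have hreg := regular_fairETCState c δ L hδ hδ1 h
  rw [hh]
  cases hst : fairETCState c δ L h with
  | identify s =>
    rw [hst] at hreg
    obtain ⟨hr, hn⟩ := hreg
    set δ' := δ / (D : ℝ) / (K : ℝ) with hδ'
    set r := s.round s(s.i, s.j) with hrdef
    have hA : fairETC c δ L h = (pureArm s.i, pureArm s.j) := by
      unfold fairETC; rw [hst]
    have hG : ∀ o : Obs K D, failProcess I c δ η L (o :: h) ≤
        compareDev I δ' s.i s.j r (s.count + 1)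
            (fun d => s.wins d + if o.2.2 d = true then 1 else 0) +
          roundBudget D δ' (Function.update s.round s(s.i, s.j) (r + 1)) +
          exploreFail K D L η := by
      intro o
      have hQ := exploreFail_nonneg (K := K) (D := D) η L
      have hB := roundBudget_nonneg (D := D) δ' (Function.update s.round s(s.i, s.j) (r + 1))
      have hC := compareDev_nonneg I δ' s.i s.j r (s.count + 1)
        (fun d => s.wins d + if o.2.2 d = true then 1 else 0)
      unfold failProcess
      split_ifs with hfo
      · rcases hfo with hfo | hfo
        · exact absurd hfo hf
        rw [hst] at hfo
        obtain ⟨hn', d, hd⟩ := hfo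
        change ¬s.count + 1 < numDuels δ' r at hn'
        change width r / 2 < _ at hd
        -- Regularity excludes a round that ends late, so the estimate uses exactly N_r samples, as
        -- `one_le_dev` requires.
        have hN : numDuels δ' r = s.count + 1 := by omega
        have hone : 1 ≤ dev (width r / 2) (I.P d s.i s.j) ((s.count + 1 : ℕ) : ℝ)
            ((s.wins d + if o.2.2 d = true then 1 else 0 : ℕ) : ℝ) ((s.count + 1 : ℕ) : ℝ) :=
          one_le_dev (by have := width_pos r; positivity) (by positivity) hd.le
        have hle : dev (width r / 2) (I.P d s.i s.j) ((s.count + 1 : ℕ) : ℝ)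
            ((s.wins d + if o.2.2 d = true then 1 else 0 : ℕ) : ℝ) ((s.count + 1 : ℕ) : ℝ) ≤
            compareDev I δ' s.i s.j r (s.count + 1)
              (fun d => s.wins d + if o.2.2 d = true then 1 else 0) := by
          unfold compareDev
          rw [hN]
          exact Finset.single_le_sum (f := fun d => dev (width r / 2) (I.P d s.i s.j)
            ((s.count + 1 : ℕ) : ℝ) ((s.wins d + if o.2.2 d = true then 1 else 0 : ℕ) : ℝ)
            ((s.count + 1 : ℕ) : ℝ)) (fun _ _ => dev_nonneg _ _ _ _ _) (Finset.mem_univ d)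
        linarith
      · have hs' : fairETCState c δ L (o :: h) = tournamentStep c δ' L (o :: h) s o.2.2 := by
          rw [fairETCState, hst]
        rw [hs']
        unfold tournamentStep
        dsimp only
        split_ifs with hlt hc
        · exact le_rfl
        · have hu := one_le_update hr s(s.i, s.j)
          have := compareDev_start_le I hδ hδ1 s.i s.j
            (Function.update s.round s(s.i, s.j) (s.round s(s.i, s.j) + 1)) hu
          simp only [failPotential]
          linarith
        · have hu := one_le_update hr s(s.i, s.j)
          have := failPotential_nextCall_le I c η L hδ hδ1 (o :: h)
            (eliminate s.cand s.i s.j (width r) (fun d =>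
              ((s.wins d + if o.2.2 d = true then 1 else 0 : ℕ) : ℝ) / ((s.count + 1 : ℕ) : ℝ)))
            (Function.update s.round s(s.i, s.j) (s.round s(s.i, s.j) + 1)) hu
          linarith
    calc ∑ o, stepProb I (fairETC c δ L) h o * failProcess I c δ η L (o :: h)
        ≤ ∑ o, stepProb I (fairETC c δ L) h o *
          (compareDev I δ' s.i s.j r (s.count + 1)
            (fun d => s.wins d + if o.2.2 d = true then 1 else 0) +
          roundBudget D δ' (Function.update s.round s(s.i, s.j) (r + 1)) +
          exploreFail K D L η) :=
          Finset.sum_le_sum fun o _ => mul_le_mul_of_nonneg_left (hG o) (stepProb_nonneg _ _ _ _)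
      _ = ∑ y, (I.feedback s.i s.j y).toReal * compareDev I δ' s.i s.j r (s.count + 1)
            (fun d => s.wins d + if y d = true then 1 else 0) +
          roundBudget D δ' (Function.update s.round s(s.i, s.j) (r + 1)) +
          exploreFail K D L η := by
          rw [sum_stepProb_pureArm I _ h hA (fun y => compareDev I δ' s.i s.j r (s.count + 1)
            (fun d => s.wins d + if y d = true then 1 else 0) +
            roundBudget D δ' (Function.update s.round s(s.i, s.j) (r + 1)) +
            exploreFail K D L η)]
          simp_rw [add_assoc, mul_add, Finset.sum_add_distrib, ← Finset.sum_mul, feedback_sum,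
            one_mul]
      _ ≤ _ := by
          have := compareDev_step_le I δ' s.i s.j r s.count s.wins
          simp only [failPotential]
          linarith
  | explore winner cur rest wins =>
    have hA : fairETC c δ L h = (pureArm cur.1, pureArm cur.2) := by
      unfold fairETC; rw [hst]
    have hG : ∀ o : Obs K D, failProcess I c δ η L (o :: h) ≤ exploreDev I η L winner
        (fun d a b => wins d a b + if (a, b) = cur ∧ o.2.2 d = true then 1 else 0) rest := by
      intro o
      unfold failProcess
      split_ifs with hfo
      · rcases hfo with hfo | hfo
        · exact absurd hfo hf
        rw [hst] at hfo
        obtain ⟨rfl, d, a, hd⟩ := hfo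
        refine (one_le_dev hη (by exact_mod_cast hL) hd.le).trans ?_
        unfold exploreDev
        simp only [List.count_nil, Nat.cast_zero, sub_zero]
        refine le_trans ?_ (Finset.single_le_sum (f := fun d => ∑ a, dev η (I.P d a (winner d)) L
          ((wins d a (winner d) + if (a, winner d) = cur ∧ o.2.2 d = true then 1 else 0 : ℕ) : ℝ)
          (L : ℝ)) (fun d _ => Finset.sum_nonneg fun _ _ => dev_nonneg _ _ _ _ _)
          (Finset.mem_univ d))
        exact Finset.single_le_sum (f := fun a => dev η (I.P d a (winner d)) L
          ((wins d a (winner d) + if (a, winner d) = cur ∧ o.2.2 d = true then 1 else 0 : ℕ) : ℝ)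
          (L : ℝ)) (fun _ _ => dev_nonneg _ _ _ _ _) (Finset.mem_univ a)
      · rw [fairETCState, hst]
        exact failPotential_continueExplore_le I c _ η L _ _ _ _
    calc ∑ o, stepProb I (fairETC c δ L) h o * failProcess I c δ η L (o :: h)
        ≤ ∑ o, stepProb I (fairETC c δ L) h o * exploreDev I η L winner
          (fun d a b => wins d a b + if (a, b) = cur ∧ o.2.2 d = true then 1 else 0) rest :=
          Finset.sum_le_sum fun o _ => mul_le_mul_of_nonneg_left (hG o) (stepProb_nonneg _ _ _ _)
      _ = _ := sum_stepProb_pureArm I _ h hA (fun y => exploreDev I η L winner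
            (fun d a b => wins d a b + if (a, b) = cur ∧ y d = true then 1 else 0) rest)
      _ ≤ _ := exploreDev_step_le I η L winner wins cur rest
  | commit π =>
    have h0 : ∀ o : Obs K D, failProcess I c δ η L (o :: h) = 0 := by
      intro o
      unfold failProcess
      rw [if_neg]
      · rw [fairETCState, hst]; rfl
      · rintro (hfo | hfo)
        · exact hf hfo
        · rw [hst] at hfo; exact hfo
    simp [h0, failPotential]

theorem failProcess_nil_le (hδ : 0 < δ / (D : ℝ) / (K : ℝ))
    (hδ1 : δ / (D : ℝ) / (K : ℝ) ≤ 1) :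
    failProcess I c δ η L [] ≤
      (K : ℝ) * K * (D * (δ / (D : ℝ) / (K : ℝ)) ^ 2) + exploreFail K D L η := by
  have h1 : failProcess I c δ η L [] = failPotential I (δ / (D : ℝ) / (K : ℝ)) η L
    (nextCall c L [] (fun _ => Finset.univ) (fun _ => 1)) := if_neg id
  rw [h1]
  refine (failPotential_nextCall_le I c η L hδ hδ1 [] _ _ fun _ => le_rfl).trans ?_
  gcongr
  unfold roundBudget
  rw [Finset.sum_const, nsmul_eq_mul, Finset.card_univ]
  simp only [Nat.cast_one, div_one]
  gcongr
  exact_mod_cast card_sym2_le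

end Analysis

section Deterministic

variable {K D : ℕ} (I : Problem K D) (aStar : Fin D → Fin K) (δ' : ℝ) (r₀ : ℕ)

/-! ### Length of a tournament without estimation failures -/

/-- The number of duels of the first `r₀` rounds of a comparison. -/
noncomputable def compareBudget (δ' : ℝ) (r₀ : ℕ) : ℕ := ∑ r ∈ Finset.Ico 1 (r₀ + 1), numDuels δ' r

/-- The number of duels of the finished rounds. -/
noncomputable def finishedDuels (δ' : ℝ) (round : Sym2 (Fin K) → ℕ) : ℕ :=
  ∑ p, ∑ r ∈ Finset.Ico 1 (round p), numDuels δ' r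

/-- Candidate sets and round trackers are consistent with the winners `aStar` and with the
separation of all pairs after `r₀` rounds. -/
structure Consistent (cand : Fin D → Finset (Fin K)) (round : Sym2 (Fin K) → ℕ) : Prop where
  winner_mem : ∀ d, aStar d ∈ cand d
  one_le : ∀ p, 1 ≤ round p
  le : ∀ p, round p ≤ r₀ + 1
  separated : ∀ i j d, i ≠ j → round s(i, j) = r₀ + 1 → ¬(i ∈ cand d ∧ j ∈ cand d)

open Classical in
/-- Invariant between two comparisons, after `t` duels. -/
structure IdleInvariant (cand : Fin D → Finset (Fin K)) (round : Sym2 (Fin K) → ℕ) (t : ℕ) :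
    Prop extends Consistent aStar r₀ cand round where
  time : t = finishedDuels δ' round
  card : (Finset.univ.filter fun p => 1 < round p).card + ∑ d, (cand d).card ≤ D * K

open Classical in
/-- Invariant during a comparison, after `t` duels. -/
structure CallInvariant (s : TournamentState K D) (t : ℕ) : Prop
    extends Consistent aStar r₀ s.cand s.round where
  ne : s.i ≠ s.j
  i_mem : s.i ∈ s.cand s.caller
  j_mem : s.j ∈ s.cand s.caller
  count_lt : s.count < numDuels δ' (s.round s(s.i, s.j))
  time : t = finishedDuels δ' s.round + s.count
  card : (Finset.univ.filter fun p => 1 < s.round p ∧ p ≠ s(s.i, s.j)).card +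
    ∑ d, (s.cand d).card ≤ D * K

variable {aStar δ' r₀}

theorem sum_numDuels_le_compareBudget {n : ℕ} (hn : n ≤ r₀ + 1) :
    ∑ r ∈ Finset.Ico 1 n, numDuels δ' r ≤ compareBudget δ' r₀ :=
  Finset.sum_le_sum_of_subset (Finset.Ico_subset_Ico_right hn)

theorem IdleInvariant.time_le {cand : Fin D → Finset (Fin K)} {round : Sym2 (Fin K) → ℕ} {t : ℕ}
    (h : IdleInvariant aStar δ' r₀ cand round t) :
    t ≤ min (K * K) (D * K) * compareBudget δ' r₀ := by
  classical
  have hcard : (Finset.univ.filter fun p => 1 < round p).card ≤ min (K * K) (D * K) := by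
    refine le_min ((Finset.card_le_univ _).trans card_sym2_le) ?_
    have := h.card
    convert (Nat.le_add_right _ _).trans this
  rw [h.time, finishedDuels]
  calc ∑ p, ∑ r ∈ Finset.Ico 1 (round p), numDuels δ' r
      = ∑ p ∈ Finset.univ.filter fun p => 1 < round p,
          ∑ r ∈ Finset.Ico 1 (round p), numDuels δ' r := by
        symm
        apply Finset.sum_filter_of_ne
        intro p _ hp
        by_contra hlt
        exact hp (by rw [Finset.Ico_eq_empty (by omega), Finset.sum_empty])
    _ ≤ ∑ p ∈ Finset.univ.filter fun p => 1 < round p, compareBudget δ' r₀ :=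
        Finset.sum_le_sum fun p _ => sum_numDuels_le_compareBudget (h.le p)
    _ = _ := by rw [Finset.sum_const, smul_eq_mul]
    _ ≤ _ := Nat.mul_le_mul_right _ hcard

/-- The caller still holds both arms, which a tracker value r₀ + 1 would forbid. -/
theorem CallInvariant.round_le {s : TournamentState K D} {t : ℕ}
    (h : CallInvariant aStar δ' r₀ s t) : s.round s(s.i, s.j) ≤ r₀ := by
  have h1 := h.le s(s.i, s.j)
  have h2 := h.separated s.i s.j s.caller h.ne
  by_contra hlt
  exact h2 (by omega) ⟨h.i_mem, h.j_mem⟩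

theorem CallInvariant.time_le {s : TournamentState K D} {t : ℕ}
    (h : CallInvariant aStar δ' r₀ s t) :
    t ≤ min (K * K) (D * K) * compareBudget δ' r₀ := by
  classical
  -- The invariant does not count the current pair; a nonempty candidate set leaves room for it
  -- within DK.
  have hsub : 1 ≤ ∑ d, (s.cand d).card :=
    (Finset.card_pos.2 ⟨_, h.i_mem⟩).trans_le
      (Finset.single_le_sum (f := fun d => (s.cand d).card) (fun _ _ => Nat.zero_le _)
        (Finset.mem_univ s.caller))
  set U := insert s(s.i, s.j)
    (Finset.univ.filter fun p => 1 < s.round p ∧ p ≠ s(s.i, s.j)) with hU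
  have hcard : U.card ≤ min (K * K) (D * K) := by
    refine le_min ((Finset.card_le_univ _).trans card_sym2_le) ?_
    have h1 : U.card ≤ (Finset.univ.filter fun p => 1 < s.round p ∧ p ≠ s(s.i, s.j)).card + 1 :=
      Finset.card_insert_le _ _
    have h2 : (Finset.univ.filter fun p => 1 < s.round p ∧ p ≠ s(s.i, s.j)).card +
      ∑ d, (s.cand d).card ≤ D * K := by convert h.card
    omega
  -- The running round has index at most r₀, so its partial count still fits into the budget of r₀
  -- full rounds.
  have hcur : ∑ r ∈ Finset.Ico 1 (s.round s(s.i, s.j)), numDuels δ' r + s.count ≤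
      compareBudget δ' r₀ := by
    have h1 := sum_numDuels_le_compareBudget (δ' := δ') (Nat.succ_le_succ h.round_le)
    rw [Finset.sum_Ico_succ_top (h.one_le _)] at h1
    have := h.count_lt
    omega
  have hmem : s(s.i, s.j) ∈ U := Finset.mem_insert_self _ _
  have hfin : finishedDuels δ' s.round =
      ∑ p ∈ U, ∑ r ∈ Finset.Ico 1 (s.round p), numDuels δ' r := by
    symm
    apply Finset.sum_subset (Finset.subset_univ _)
    intro p _ hp
    have : ¬ 1 < s.round p := by
      intro hlt
      apply hp
      rw [hU, Finset.mem_insert, Finset.mem_filter]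
      by_cases hpc : p = s(s.i, s.j)
      · exact Or.inl hpc
      · exact Or.inr ⟨Finset.mem_univ _, hlt, hpc⟩
    rw [Finset.Ico_eq_empty (by omega), Finset.sum_empty]
  rw [h.time, hfin, ← Finset.add_sum_erase _ _ hmem]
  calc _ = (∑ r ∈ Finset.Ico 1 (s.round s(s.i, s.j)), numDuels δ' r + s.count) +
        ∑ p ∈ U.erase s(s.i, s.j), ∑ r ∈ Finset.Ico 1 (s.round p), numDuels δ' r := by ring
    _ ≤ compareBudget δ' r₀ + ∑ p ∈ U.erase s(s.i, s.j), compareBudget δ' r₀ :=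
        add_le_add hcur (Finset.sum_le_sum fun p _ => sum_numDuels_le_compareBudget (h.le p))
    _ = U.card * compareBudget δ' r₀ := by
        rw [Finset.sum_const, smul_eq_mul, ← Finset.card_erase_add_one hmem]; ring
    _ ≤ _ := Nat.mul_le_mul_right _ hcard

theorem finishedDuels_update (round : Sym2 (Fin K) → ℕ) (q : Sym2 (Fin K)) (hq : 1 ≤ round q) :
    finishedDuels δ' (Function.update round q (round q + 1)) =
      finishedDuels δ' round + numDuels δ' (round q) := by
  classical
  unfold finishedDuels
  rw [← Finset.add_sum_erase _ _ (Finset.mem_univ q),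
    ← Finset.add_sum_erase (a := q)
      (f := fun p => ∑ r ∈ Finset.Ico 1 (round p), numDuels δ' r) _ (Finset.mem_univ q),
    Function.update_self, Finset.sum_Ico_succ_top hq]
  have : ∑ p ∈ Finset.univ.erase q,
      ∑ r ∈ Finset.Ico 1 (Function.update round q (round q + 1) p), numDuels δ' r =
      ∑ p ∈ Finset.univ.erase q, ∑ r ∈ Finset.Ico 1 (round p), numDuels δ' r := by
    refine Finset.sum_congr rfl fun p hp => ?_
    rw [Function.update_of_ne (Finset.ne_of_mem_erase hp)]
  rw [this]; ring

/-! ### Elimination with accurate estimates -/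

theorem eliminate_subset (cand : Fin D → Finset (Fin K)) (i j : Fin K) (w : ℝ) (phat : Fin D → ℝ)
    (d : Fin D) : eliminate cand i j w phat d ⊆ cand d := by
  unfold eliminate
  split_ifs
  · exact Finset.erase_subset _ _
  · exact Finset.erase_subset _ _
  · exact subset_rfl

/-- An elimination needs an empirical lead above w/2, more than the estimation error, so the removed
arm truly loses; a Condorcet winner loses to nobody. -/
theorem winner_mem_eliminate (hwin : ∀ d, I.IsCondorcetWinner d (aStar d))
    {cand : Fin D → Finset (Fin K)} {i j : Fin K} (hij : i ≠ j) {w : ℝ} {phat : Fin D → ℝ}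
    (hp : ∀ d, |phat d - I.P d i j| ≤ w / 2) {d : Fin D} (hd : aStar d ∈ cand d) :
    aStar d ∈ eliminate cand i j w phat d := by
  have hpd := abs_le.1 (hp d)
  unfold eliminate
  split_ifs with h1 h2
  · refine Finset.mem_erase.2 ⟨fun he => ?_, hd⟩
    have h3 := hwin d i (by rw [he]; exact hij)
    rw [he] at h3
    have h4 := I.P_add d i j
    rw [abs_of_pos (by linarith)] at h1
    linarith [h1.2.2]
  · refine Finset.mem_erase.2 ⟨fun he => ?_, hd⟩
    have h3 := hwin d j (by rw [he]; exact hij.symm)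
    rw [he] at h3
    rw [abs_of_nonpos (by linarith)] at h1
    linarith [h1.2.2]
  · exact hd

/-- The empirical lead is at least Δ - w/2 > w/2, whoever the user is. -/
theorem eliminate_separates {Δ : ℝ} {cand : Fin D → Finset (Fin K)} {i j : Fin K} {w : ℝ}
    {phat : Fin D → ℝ} (hgap : ∀ d, Δ ≤ |1 / 2 - I.P d i j|) (hw : w < Δ)
    (hp : ∀ d, |phat d - I.P d i j| ≤ w / 2) (d : Fin D) :
    ¬(i ∈ eliminate cand i j w phat d ∧ j ∈ eliminate cand i j w phat d) := by
  have h2 : w / 2 < |phat d - 1 / 2| := by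
    have h3 := abs_add_le (1 / 2 - phat d) (phat d - I.P d i j)
    rw [show 1 / 2 - phat d + (phat d - I.P d i j) = 1 / 2 - I.P d i j by ring,
      abs_sub_comm (1 / 2) (phat d)] at h3
    linarith [hgap d, hp d]
  unfold eliminate
  rintro ⟨hi, hj⟩
  split_ifs at hi hj with h1 h4
  · simp at hj
  · simp at hi
  · exact h1 ⟨hi, hj, h2⟩

/-- A tracker reaches r₀ + 1 only through a round of width below Δ, which separates the pair for all
users simultaneously. Hence no later call, by any user, reopens it. -/
theorem Consistent.eliminate (hwin : ∀ d, I.IsCondorcetWinner d (aStar d)) {Δ : ℝ}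
    (hgap : ∀ d i j, i ≠ j → Δ ≤ |1 / 2 - I.P d i j|) (hr₀ : width r₀ < Δ)
    {cand : Fin D → Finset (Fin K)} {round : Sym2 (Fin K) → ℕ}
    (h : Consistent aStar r₀ cand round) {i j : Fin K} (hij : i ≠ j)
    (hle : round s(i, j) ≤ r₀) {phat : Fin D → ℝ}
    (hp : ∀ d, |phat d - I.P d i j| ≤ width (round s(i, j)) / 2) :
    Consistent aStar r₀ (eliminate cand i j (width (round s(i, j))) phat)
      (Function.update round s(i, j) (round s(i, j) + 1)) where
  winner_mem d := winner_mem_eliminate I hwin hij hp (h.winner_mem d)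
  one_le := one_le_update h.one_le _
  le p := by
    rw [Function.update_apply]
    split_ifs
    · omega
    · exact h.le p
  separated a b d hab hr hmem := by
    rw [Function.update_apply] at hr
    split_ifs at hr with heq
    · have hr' : round s(i, j) = r₀ := by omega
      rw [hr'] at hmem hp
      have := eliminate_separates I (cand := cand) (fun d => hgap d i j hij) hr₀ hp d
      rcases Sym2.eq_iff.1 heq with ⟨rfl, rfl⟩ | ⟨rfl, rfl⟩
      · exact this hmem
      · exact this hmem.symm
    · exact h.separated a b d hab hr ⟨eliminate_subset _ _ _ _ _ _ hmem.1,
        eliminate_subset _ _ _ _ _ _ hmem.2⟩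

/-! ### Trivial regret bounds -/

variable {πStar : Policy K}

theorem score_nonneg (d : Fin D) (a : Fin K) : 0 ≤ I.score aStar d a :=
  mul_nonneg zero_le_two (I.P_mem d a (aStar d)).1

theorem score_le_one (hwin : ∀ d, I.IsCondorcetWinner d (aStar d)) (d : Fin D) (a : Fin K) :
    I.score aStar d a ≤ 1 := by
  unfold Problem.score
  by_cases ha : a = aStar d
  · rw [ha, I.P_self]; norm_num
  · have := hwin d a ha
    have := I.P_add d a (aStar d)
    linarith

theorem trajRegret_cons_le (hwin : ∀ d, I.IsCondorcetWinner d (aStar d)) (A : Algorithm K D)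
    (o : Obs K D) (h : List (Obs K D)) :
    trajRegret (I.score aStar) πStar A (o :: h) ≤ trajRegret (I.score aStar) πStar A h + 1 := by
  have h1 := nsw_le_one πStar (score_nonneg I (aStar := aStar)) (score_le_one I hwin)
  have h2 := nsw_nonneg (A h).1 (score_nonneg I (aStar := aStar))
  have h3 := nsw_nonneg (A h).2 (score_nonneg I (aStar := aStar))
  simp only [trajRegret]
  linarith

theorem trajRegret_le_length (hwin : ∀ d, I.IsCondorcetWinner d (aStar d)) (A : Algorithm K D)
    (h : List (Obs K D)) : trajRegret (I.score aStar) πStar A h ≤ h.length := by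
  induction h with
  | nil => simp [trajRegret]
  | cons o h ih =>
    have := trajRegret_cons_le I (πStar := πStar) hwin A o h
    rw [List.length_cons]
    push_cast
    linarith

theorem expectedRegret_le_horizon (hwin : ∀ d, I.IsCondorcetWinner d (aStar d))
    (A : Algorithm K D) (T : ℕ) : expectedRegret I (I.score aStar) πStar A T ≤ T := by
  have := expectedRegret_le I A (I.score aStar) πStar T (fun _ => 1)
    (fun h => by simp [stepProb_sum]) (a := T) (b := 0) (by positivity) le_rfl fun h hlen => by
      have := trajRegret_le_length I (πStar := πStar) hwin A h
      rw [hlen] at this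
      linarith
  simpa using this

end Deterministic

section Regret

variable {K D : ℕ} [NeZero K] (I : Problem K D) (aStar : Fin D → Fin K) (c : Choices K D)
  (δ' δ η : ℝ) (L r₀ : ℕ) (πStar : Policy K) (κ : ℝ)

/-! ### Regret without estimation failures -/

/-- The number of rounds before the commitment, if no estimate fails. -/
noncomputable def learningBudget : ℕ :=
  min (K * K) (D * K) * compareBudget δ' r₀ + (Finset.univ.image aStar).card * (K * L)

/-- Invariant of a run without estimation failures: after `t` rounds with accumulated regret `ρ`. -/
def RunInvariant : State K D → ℕ → ℝ → Prop
  | State.identify s, t, ρ => ρ ≤ t ∧ CallInvariant aStar δ' r₀ s t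
  | State.explore winner _ rest _, _, ρ =>
      winner = aStar ∧ ρ + (rest.length + 1) ≤ learningBudget aStar δ' L r₀
  | State.commit π, t, ρ =>
      ρ ≤ learningBudget aStar δ' L r₀ + t * κ ∧
        nsw πStar (I.score aStar) - nsw π (I.score aStar) ≤ κ

variable {aStar δ' δ L r₀ πStar κ}

theorem runInvariant_nextCall (hδ : 0 < δ') (hδ1 : δ' ≤ 1) (hK : 1 ≤ K) (hD : 1 ≤ D) (hL : 0 < L)
    (hist : List (Obs K D)) {cand : Fin D → Finset (Fin K)} {round : Sym2 (Fin K) → ℕ} {t : ℕ}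
    {ρ : ℝ} (hρ : ρ ≤ t) (h : IdleInvariant aStar δ' r₀ cand round t) :
    RunInvariant I aStar δ' L r₀ πStar κ (nextCall c L hist cand round) t ρ := by
  classical
  unfold nextCall
  split_ifs with hc
  · obtain ⟨h1, h2, h3, h4⟩ := c.select_spec hist cand hc
    refine ⟨hρ, ⟨h.toConsistent, h4, h2, h3, numDuels_pos hδ hδ1 (h.one_le _), ?_, ?_⟩⟩
    · simpa using h.time
    · refine le_trans (Nat.add_le_add_right (Finset.card_le_card ?_) _) h.card
      intro p hp
      rw [Finset.mem_filter] at hp ⊢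
      exact ⟨hp.1, hp.2.1⟩
  · have hw : (fun d => survivor (cand d)) = aStar := by
      funext d
      have hne : (cand d).Nonempty := ⟨_, h.winner_mem d⟩
      have hle : (cand d).card ≤ 1 := not_lt.1 fun hlt => hc ⟨d, hlt⟩
      rw [survivor, dif_pos hne]
      exact Finset.card_le_one.1 hle _ (Finset.min'_mem _ _) _ (h.winner_mem d)
    rw [hw]
    have hlen := length_schedule L aStar
    have hm : 0 < (Finset.univ.image aStar).card :=
      Finset.card_pos.2 ⟨_, Finset.mem_image_of_mem _ (Finset.mem_univ ⟨0, hD⟩)⟩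
    -- The empty schedule is impossible because L > 0; it would mean committing without any
    -- estimate.
    cases hs : schedule L aStar with
    | nil =>
      rw [hs, List.length_nil] at hlen
      have : 0 < (Finset.univ.image aStar).card * (K * L) := by positivity
      omega
    | cons p ps =>
      refine ⟨rfl, ?_⟩
      rw [hs, List.length_cons] at hlen
      have ht := h.time_le
      have : t + (ps.length + 1) ≤ learningBudget aStar δ' L r₀ := by
        unfold learningBudget; omega
      have : ((t + (ps.length + 1) : ℕ) : ℝ) ≤ (learningBudget aStar δ' L r₀ : ℕ) := by
        exact_mod_cast this
      push_cast at this
      linarith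

theorem runInvariant_tournamentStep (hwin : ∀ d, I.IsCondorcetWinner d (aStar d)) {Δ : ℝ}
    (hgap : ∀ d i j, i ≠ j → Δ ≤ |1 / 2 - I.P d i j|) (hr₀ : width r₀ < Δ)
    (hδ : 0 < δ') (hδ1 : δ' ≤ 1) (hK : 1 ≤ K) (hD : 1 ≤ D) (hL : 0 < L)
    (hist : List (Obs K D)) {s : TournamentState K D} {y : Fin D → Bool} {t : ℕ} {ρ : ℝ}
    (hρ : ρ ≤ (t + 1 : ℕ)) (h : CallInvariant aStar δ' r₀ s t)
    (hf : ¬ failStep I δ' η L (State.identify s) y) :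
    RunInvariant I aStar δ' L r₀ πStar κ (tournamentStep c δ' L hist s y) (t + 1) ρ := by
  classical
  unfold tournamentStep
  dsimp only
  split_ifs with hn hcall
  · exact ⟨hρ, ⟨h.toConsistent, h.ne, h.i_mem, h.j_mem, hn, by rw [h.time]; rfl, h.card⟩⟩
  all_goals
    set phat : Fin D → ℝ := fun d =>
      ((s.wins d + if y d = true then 1 else 0 : ℕ) : ℝ) / ((s.count + 1 : ℕ) : ℝ) with hphat
    have hp : ∀ d, |phat d - I.P d s.i s.j| ≤ width (s.round s(s.i, s.j)) / 2 := by
      intro d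
      by_contra hlt
      exact hf ⟨hn, d, not_le.1 hlt⟩
    have hcons := h.toConsistent.eliminate I hwin hgap hr₀ h.ne h.round_le hp
    have htime : t + 1 = finishedDuels δ'
        (Function.update s.round s(s.i, s.j) (s.round s(s.i, s.j) + 1)) := by
      rw [finishedDuels_update _ _ (h.one_le _), h.time]
      have := h.count_lt
      omega
    have hsub := eliminate_subset s.cand s.i s.j (width (s.round s(s.i, s.j))) phat
  · refine ⟨hρ, ⟨hcons, h.ne, hcall.1, hcall.2, numDuels_pos hδ hδ1 (hcons.one_le _), htime, ?_⟩⟩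
    refine le_trans (add_le_add (Finset.card_le_card ?_)
      (Finset.sum_le_sum fun d _ => Finset.card_le_card (hsub d))) h.card
    intro p hpm
    rw [Finset.mem_filter] at hpm ⊢
    have := hpm.2
    dsimp only at this
    rw [Function.update_of_ne this.2] at this
    exact ⟨hpm.1, this⟩
  · refine runInvariant_nextCall I c hδ hδ1 hK hD hL hist hρ ⟨hcons, htime, ?_⟩
    -- The call ended because the caller lost an arm; this decrease pays for counting the current
    -- pair among the started ones.
    have hlt : ∑ d, (eliminate s.cand s.i s.j (width (s.round s(s.i, s.j))) phat d).card <
        ∑ d, (s.cand d).card := by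
      refine Finset.sum_lt_sum (fun d _ => Finset.card_le_card (hsub d))
        ⟨s.caller, Finset.mem_univ _, Finset.card_lt_card ((hsub _).ssubset_of_ne fun he => ?_)⟩
      apply hcall
      rw [he]
      exact ⟨h.i_mem, h.j_mem⟩
    have hins : (Finset.univ.filter fun p => 1 < Function.update s.round s(s.i, s.j)
        (s.round s(s.i, s.j) + 1) p) ⊆
        insert s(s.i, s.j) (Finset.univ.filter fun p => 1 < s.round p ∧ p ≠ s(s.i, s.j)) := by
      intro p hpm
      rw [Finset.mem_filter] at hpm
      rw [Finset.mem_insert, Finset.mem_filter]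
      by_cases hpc : p = s(s.i, s.j)
      · exact Or.inl hpc
      · rw [Function.update_of_ne hpc] at hpm
        exact Or.inr ⟨hpm.1, hpm.2, hpc⟩
    have h1 := (Finset.card_le_card hins).trans (Finset.card_insert_le _ _)
    have h2 := h.card
    have h2' : (Finset.univ.filter fun p => 1 < s.round p ∧ p ≠ s(s.i, s.j)).card +
      ∑ d, (s.cand d).card ≤ D * K := by convert h2
    refine le_trans ?_ h2'
    have h1' : (Finset.univ.filter fun p => 1 < Function.update s.round s(s.i, s.j)
        (s.round s(s.i, s.j) + 1) p).card ≤
        (Finset.univ.filter fun p => 1 < s.round p ∧ p ≠ s(s.i, s.j)).card + 1 := h1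
    have h3 : ∀ a b e f : ℕ, a ≤ b + 1 → e < f → a + e ≤ b + f := fun a b e f _ _ => by omega
    convert h3 _ _ _ _ h1' hlt

/-- Before the commitment regret is charged one unit per round against the learning budget;
afterwards each round costs 4D · 2η, because scores are twice the estimated probabilities. -/
theorem runInvariant_of_not_failed (hwin : ∀ d, I.IsCondorcetWinner d (aStar d)) {Δ : ℝ}
    (hgap : ∀ d i j, i ≠ j → Δ ≤ |1 / 2 - I.P d i j|) (hr₀ : width r₀ < Δ) (hr₀1 : 1 ≤ r₀)
    (hδ : 0 < δ / (D : ℝ) / (K : ℝ)) (hδ1 : δ / (D : ℝ) / (K : ℝ) ≤ 1) (hK : 1 ≤ K) (hD : 1 ≤ D)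
    (hL : 0 < L) (hη : 0 ≤ η) (hist : List (Obs K D)) (hf : ¬ Failed I c δ η L hist) :
    RunInvariant I aStar (δ / (D : ℝ) / (K : ℝ)) L r₀ πStar (4 * (D * (2 * η)))
      (fairETCState c δ L hist) hist.length
      (trajRegret (I.score aStar) πStar (fairETC c δ L) hist) := by
  have hκ : 0 ≤ 4 * (D * (2 * η)) := by positivity
  induction hist with
  | nil =>
    refine runInvariant_nextCall I c hδ hδ1 hK hD hL [] (by simp [trajRegret])
      ⟨⟨fun d => Finset.mem_univ _, fun p => le_rfl, fun p => by omega, fun i j d _ h1 => ?_⟩,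
        ?_, ?_⟩
    · omega
    · simp [finishedDuels]
    · simp
  | cons o hist ih =>
    have hf1 : ¬ Failed I c δ η L hist := fun h => hf (Or.inl h)
    have hf2 : ¬ failStep I (δ / (D : ℝ) / (K : ℝ)) η L (fairETCState c δ L hist) o.2.2 :=
      fun h => hf (Or.inr h)
    have ih := ih hf1
    have hreg := trajRegret_cons_le I (πStar := πStar) hwin (fairETC c δ L) o hist
    rw [List.length_cons]
    cases hst : fairETCState c δ L hist with
    | identify s =>
      rw [hst] at ih hf2
      rw [fairETCState, hst]
      refine runInvariant_tournamentStep I c η hwin hgap hr₀ hδ hδ1 hK hD hL _ ?_ ih.2 hf2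
      have := ih.1
      push_cast
      linarith
    | explore winner cur rest wins =>
      rw [hst] at ih hf2
      obtain ⟨rfl, hρ⟩ := ih
      rw [fairETCState, hst]
      cases rest with
      | cons p ps =>
        refine ⟨rfl, ?_⟩
        rw [List.length_cons] at hρ
        push_cast at hρ
        linarith
      | nil =>
        simp only [List.length_nil, Nat.cast_zero, zero_add] at hρ
        refine ⟨?_, ?_⟩
        · have : 0 ≤ ((hist.length + 1 : ℕ) : ℝ) * (4 * (D * (2 * η))) := by positivity
          linarith
        · refine nsw_sub_le_of_argmax (score_nonneg I) (score_le_one I hwin) (fun d a => ?_)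
            (fun d a => ?_) (by positivity) (c.argmax_spec (o :: hist) _ πStar)
          · unfold estScore; positivity
          · have hle := not_lt.1 fun hlt => hf2 ⟨rfl, d, a, hlt⟩
            unfold estScore Problem.score
            rw [← mul_sub, abs_mul, abs_two]
            linarith
    | commit π =>
      rw [hst] at ih
      rw [fairETCState, hst]
      refine ⟨?_, ih.2⟩
      have hA : fairETC c δ L hist = (π, π) := by unfold fairETC; rw [hst]
      simp only [trajRegret, hA]
      have h1 := ih.1
      have h2 := ih.2
      push_cast
      linarith

/-- Pathwise regret bound for runs without estimation failures. -/
theorem trajRegret_le_of_not_failed (hwin : ∀ d, I.IsCondorcetWinner d (aStar d)) {Δ : ℝ}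
    (hgap : ∀ d i j, i ≠ j → Δ ≤ |1 / 2 - I.P d i j|) (hr₀ : width r₀ < Δ) (hr₀1 : 1 ≤ r₀)
    (hδ : 0 < δ / (D : ℝ) / (K : ℝ)) (hδ1 : δ / (D : ℝ) / (K : ℝ) ≤ 1) (hK : 1 ≤ K) (hD : 1 ≤ D)
    (hL : 0 < L) (hη : 0 ≤ η) (hist : List (Obs K D)) (hf : ¬ Failed I c δ η L hist) :
    trajRegret (I.score aStar) πStar (fairETC c δ L) hist ≤
      learningBudget aStar (δ / (D : ℝ) / (K : ℝ)) L r₀ + hist.length * (4 * (D * (2 * η))) := by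
  have hκ : 0 ≤ (hist.length : ℝ) * (4 * (D * (2 * η))) := by positivity
  have h := runInvariant_of_not_failed I c η (πStar := πStar) hwin hgap hr₀ hr₀1 hδ hδ1 hK hD hL hη
    hist hf
  cases hst : fairETCState c δ L hist with
  | identify s =>
    rw [hst] at h
    have ht : hist.length ≤ learningBudget aStar (δ / (D : ℝ) / (K : ℝ)) L r₀ :=
      h.2.time_le.trans (Nat.le_add_right _ _)
    have ht' : (hist.length : ℝ) ≤ learningBudget aStar (δ / (D : ℝ) / (K : ℝ)) L r₀ := by
      exact_mod_cast ht
    linarith [h.1]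
  | explore winner cur rest wins =>
    rw [hst] at h
    have : (0 : ℝ) ≤ rest.length := by positivity
    linarith [h.2]
  | commit π =>
    rw [hst] at h
    exact h.1

/-- The expected regret of Fair-ETC in terms of its parameters. -/
theorem expectedRegret_fairETC_le (hwin : ∀ d, I.IsCondorcetWinner d (aStar d)) {Δ : ℝ}
    (hgap : ∀ d i j, i ≠ j → Δ ≤ |1 / 2 - I.P d i j|) (hr₀ : width r₀ < Δ) (hr₀1 : 1 ≤ r₀)
    (hδ : 0 < δ / (D : ℝ) / (K : ℝ)) (hδ1 : δ / (D : ℝ) / (K : ℝ) ≤ 1) (hK : 1 ≤ K) (hD : 1 ≤ D)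
    (hL : 0 < L) (hη : 0 ≤ η) (T : ℕ) :
    expectedRegret I (I.score aStar) πStar (fairETC c δ L) T ≤
      learningBudget aStar (δ / (D : ℝ) / (K : ℝ)) L r₀ + T * (4 * (D * (2 * η))) +
        T * ((K : ℝ) * K * (D * (δ / (D : ℝ) / (K : ℝ)) ^ 2) + exploreFail K D L η) := by
  refine (expectedRegret_le I _ _ _ T (failProcess I c δ η L)
    (failProcess_supermartingale I c δ η L hδ hδ1 hη hL)
    (a := learningBudget aStar (δ / (D : ℝ) / (K : ℝ)) L r₀ + T * (4 * (D * (2 * η))))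
    (b := T) (by positivity) (by positivity) fun h hlen => ?_).trans ?_
  · by_cases hf : Failed I c δ η L h
    · rw [show failProcess I c δ η L h = 1 from if_pos hf]
      have h1 := trajRegret_le_length I (πStar := πStar) hwin (fairETC c δ L) h
      rw [hlen] at h1
      have : 0 ≤ (learningBudget aStar (δ / (D : ℝ) / (K : ℝ)) L r₀ : ℝ) +
        T * (4 * (D * (2 * η))) := by positivity
      linarith
    · have h1 := trajRegret_le_of_not_failed I c η (πStar := πStar) hwin hgap hr₀ hr₀1 hδ hδ1 hK hD
        hL hη h hf
      rw [hlen] at h1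
      have := mul_nonneg (Nat.cast_nonneg (α := ℝ) T) (failProcess_nonneg I c δ η L h)
      linarith
  · have := mul_le_mul_of_nonneg_left (failProcess_nil_le I c δ η L hδ hδ1)
      (Nat.cast_nonneg (α := ℝ) T)
    linarith

end Regret

/-! ### Numerical bounds -/

theorem sum_four_pow_le (r₀ : ℕ) : ∑ r ∈ Finset.Ico 1 (r₀ + 1), (4 : ℝ) ^ r ≤ 2 * 4 ^ r₀ - 2 := by
  induction r₀ with
  | zero => simp
  | succ n ih =>
    rw [Finset.sum_Ico_succ_top (by omega)]
    have : (1 : ℝ) ≤ 4 ^ n := one_le_pow₀ (by norm_num)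
    rw [pow_succ]
    linarith

theorem log_seven_le_two : Real.log 7 ≤ 2 := by
  rw [Real.log_le_iff_le_exp (by norm_num), show (2 : ℝ) = 1 + 1 by norm_num, Real.exp_add]
  nlinarith [Real.exp_one_gt_d9]

theorem one_le_log_seven : 1 ≤ Real.log 7 := by
  rw [Real.le_log_iff_exp_le (by norm_num)]
  linarith [Real.exp_one_lt_d9]

theorem compareBudget_le {δ' : ℝ} (h : 0 < δ') (h1 : δ' ≤ 1) {r₀ : ℕ} (hr₀ : 1 ≤ r₀) :
    (compareBudget δ' r₀ : ℝ) ≤ 66 * 4 ^ r₀ * Real.log (7 * (r₀ : ℝ) ^ 2 / δ') := by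
  have hr₀' : (1 : ℝ) ≤ r₀ := by exact_mod_cast hr₀
  set Λ := Real.log (7 * (r₀ : ℝ) ^ 2 / δ') with hΛ
  have hΛ1 : 1 ≤ Λ := by
    refine one_le_log_seven.trans (Real.log_le_log (by norm_num) ?_)
    rw [le_div_iff₀ h]
    nlinarith
  -- Here 33 = 8 · 4 + 1: 1/h_r² = 4 · 4^r, and the rounding up costs at most 4^r Λ. The geometric
  -- sum then doubles the last term.
  have hN : ∀ r ∈ Finset.Ico 1 (r₀ + 1), (numDuels δ' r : ℝ) ≤ 33 * 4 ^ r * Λ := by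
    intro r hr
    obtain ⟨hr1, hr2⟩ := Finset.mem_Ico.1 hr
    have hr1' : (1 : ℝ) ≤ r := by exact_mod_cast hr1
    have hr2' : (r : ℝ) ≤ r₀ := by exact_mod_cast Nat.lt_succ_iff.1 hr2
    have hc := roundConf_pos h hr1
    have hc1 := roundConf_le_one h h1 hr1
    have hlog0 : 0 ≤ Real.log (4 / roundConf δ' r) :=
      Real.log_nonneg (by rw [le_div_iff₀ hc]; linarith)
    have hlog : Real.log (4 / roundConf δ' r) ≤ Λ := by
      refine Real.log_le_log (by positivity) ?_
      have e : 4 / roundConf δ' r = (4 * Real.pi ^ 2 / 6) * (r : ℝ) ^ 2 / δ' := by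
        unfold roundConf
        field_simp
      rw [e]
      have hpi : 4 * Real.pi ^ 2 / 6 ≤ 7 := by
        nlinarith [Real.pi_lt_d2, Real.pi_pos]
      gcongr
    have hw : 1 / width r ^ 2 = 4 * 4 ^ r := by
      unfold width
      rw [← pow_mul, mul_comm (r + 1) 2, pow_mul, pow_succ, one_div, mul_inv, ← inv_pow]
      norm_num [mul_comm]
    have hceil : (numDuels δ' r : ℝ) ≤ 8 * Real.log (4 / roundConf δ' r) / width r ^ 2 + 1 :=
      (Nat.ceil_lt_add_one (by positivity)).le
    have h4 : (1 : ℝ) ≤ 4 ^ r := one_le_pow₀ (by norm_num)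
    rw [div_eq_mul_one_div, hw] at hceil
    have h5 : Real.log (4 / roundConf δ' r) * 4 ^ r ≤ Λ * 4 ^ r := by gcongr
    have h6 : 1 ≤ 4 ^ r * Λ := one_le_mul_of_one_le_of_one_le h4 hΛ1
    linarith
  unfold compareBudget
  push_cast
  calc ∑ r ∈ Finset.Ico 1 (r₀ + 1), (numDuels δ' r : ℝ)
      ≤ ∑ r ∈ Finset.Ico 1 (r₀ + 1), 33 * 4 ^ r * Λ := Finset.sum_le_sum hN
    _ = 33 * (∑ r ∈ Finset.Ico 1 (r₀ + 1), (4 : ℝ) ^ r) * Λ := by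
        rw [Finset.mul_sum, Finset.sum_mul]
    _ ≤ 33 * (2 * 4 ^ r₀) * Λ := by
        have := sum_four_pow_le r₀
        gcongr
        linarith
    _ = _ := by ring

/-- The number of comparisons of a pair needed to resolve a gap `Δ`. -/
theorem exists_round {Δ : ℝ} (hΔ : 0 < Δ) (hΔ2 : Δ ≤ 1 / 2) :
    ∃ r₀ : ℕ, 1 ≤ r₀ ∧ width r₀ < Δ ∧ (4 : ℝ) ^ r₀ ≤ 1 / Δ ^ 2 ∧
      Real.log r₀ ≤ Real.log (Real.log (1 / Δ)) + 1 := by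
  have hx : 2 ≤ 1 / Δ := by rw [le_div_iff₀ hΔ]; linarith
  -- The witness satisfies 2^n ≤ 1/Δ < 2^(n+1): the upper bound gives the width, the lower one the
  -- cost.
  obtain ⟨n, hn1, hn2⟩ := exists_nat_pow_near (x := 1 / Δ) (y := 2) (by linarith) (by norm_num)
  have hn : 1 ≤ n := by
    by_contra h0
    have : n = 0 := by omega
    subst this
    norm_num at hn2
    rw [one_div] at hx
    linarith
  have hn' : (1 : ℝ) ≤ n := by exact_mod_cast hn
  refine ⟨n, hn, ?_, ?_, ?_⟩
  · unfold width
    rw [one_div, inv_pow]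
    rw [div_lt_iff₀ hΔ] at hn2
    exact (inv_lt_iff_one_lt_mul₀' (by positivity)).2 hn2
  · calc (4 : ℝ) ^ n = (2 ^ n) ^ 2 := by rw [← pow_mul, mul_comm, pow_mul]; norm_num
      _ ≤ (1 / Δ) ^ 2 := by gcongr
      _ = _ := by rw [div_pow, one_pow]
  · have h1 : (n : ℝ) * Real.log 2 ≤ Real.log (1 / Δ) := by
      rw [← Real.log_pow]
      exact Real.log_le_log (by positivity) hn1
    have h2 := Real.log_two_gt_d9
    have h3 := Real.log_two_lt_d9
    have h4 : (n : ℝ) ≤ Real.log (1 / Δ) * 2 := by nlinarith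
    have h5 : 0 < Real.log (1 / Δ) := by nlinarith
    have h6 := Real.log_le_log (by linarith) h4
    rw [Real.log_mul h5.ne' (by norm_num)] at h6
    linarith

/-- The number of distinct compared pairs compensates the union bound over the users. -/
theorem min_mul_log_le {K D : ℕ} (hK : 3 ≤ K) (hD : 1 ≤ D) :
    ((min (K * K) (D * K) : ℕ) : ℝ) * Real.log D ≤ D * K * Real.log K := by
  have hK' : (3 : ℝ) ≤ K := by exact_mod_cast hK
  have hD' : (1 : ℝ) ≤ D := by exact_mod_cast hD
  have hlD : 0 ≤ Real.log D := Real.log_nonneg hD'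
  rcases le_total D K with h | h
  · have hDK : (D : ℝ) ≤ K := by exact_mod_cast h
    have h1 : ((min (K * K) (D * K) : ℕ) : ℝ) ≤ D * K := by
      exact_mod_cast min_le_right (K * K) (D * K)
    gcongr
  · have hDK : (K : ℝ) ≤ D := by exact_mod_cast h
    have h1 : ((min (K * K) (D * K) : ℕ) : ℝ) ≤ K * K := by
      exact_mod_cast min_le_left (K * K) (D * K)
    have he : Real.exp 1 ≤ K := by linarith [Real.exp_one_lt_d9]
    -- As log x / x decreases beyond e, K ≤ D gives K log D ≤ D log K.
    have h2 := Real.log_div_self_antitoneOn (a := (K : ℝ)) (b := D) he (he.trans hDK) hDK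
    dsimp only at h2
    rw [div_le_div_iff₀ (by linarith) (by linarith)] at h2
    calc _ ≤ K * K * Real.log D := by gcongr
      _ = K * (Real.log D * K) := by ring
      _ ≤ K * (Real.log K * D) := by gcongr
      _ = _ := by ring

theorem third_le_log_half {K : ℕ} (hK : 3 ≤ K) : 1 / 3 ≤ Real.log ((K : ℝ) / 2) := by
  have hK' : (3 : ℝ) ≤ K := by exact_mod_cast hK
  refine le_trans ?_ (Real.one_sub_inv_le_log_of_pos (by positivity))
  rw [inv_div]
  have : 2 / (K : ℝ) ≤ 2 / 3 := by gcongr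
  linarith

theorem log_le_four_mul_log_half {K : ℕ} (hK : 3 ≤ K) :
    Real.log K ≤ 4 * Real.log ((K : ℝ) / 2) := by
  have hK' : (3 : ℝ) ≤ K := by exact_mod_cast hK
  have h := third_le_log_half hK
  rw [Real.log_div (by positivity) (by norm_num)] at h ⊢
  linarith [Real.log_two_lt_d9]

/-- The cost of the tournament. -/
theorem tournament_cost_le {K D : ℕ} (hK : 3 ≤ K) (hD : 1 ≤ D) {δ Δ : ℝ} (hδ : 0 < δ) (hδ1 : δ ≤ 1)
    (hΔ : 0 < Δ) {r₀ : ℕ} (hr₀ : 1 ≤ r₀) (h4 : (4 : ℝ) ^ r₀ ≤ 1 / Δ ^ 2)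
    (hlog : Real.log r₀ ≤ Real.log (Real.log (1 / Δ)) + 1) :
    ((min (K * K) (D * K) : ℕ) : ℝ) * (compareBudget (δ / (D : ℝ) / (K : ℝ)) r₀ : ℝ) ≤
      2244 * ((K : ℝ) * D / Δ ^ 2 * Real.log ((K : ℝ) / 2) *
        max 1 (Real.log (Real.log (1 / Δ)) + Real.log (1 / (δ * D)))) := by
  have hK' : (3 : ℝ) ≤ K := by exact_mod_cast hK
  have hD' : (1 : ℝ) ≤ D := by exact_mod_cast hD
  have hr₀' : (1 : ℝ) ≤ r₀ := by exact_mod_cast hr₀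
  have hlD : 0 ≤ Real.log D := Real.log_nonneg hD'
  have hlK : 0 ≤ Real.log K := Real.log_nonneg (by linarith)
  have hδ' : 0 < δ / (D : ℝ) / (K : ℝ) := by positivity
  have hδ'1 : δ / (D : ℝ) / (K : ℝ) ≤ 1 := by
    rw [div_div, div_le_one (by positivity)]
    nlinarith
  have hB := compareBudget_le hδ' hδ'1 hr₀
  set M := max 1 (Real.log (Real.log (1 / Δ)) + Real.log (1 / (δ * D))) with hM
  have hM1 : 1 ≤ M := le_max_left _ _
  have hM2 : Real.log (Real.log (1 / Δ)) + Real.log (1 / (δ * D)) ≤ M := le_max_right _ _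
  have hY : Real.log (1 / (δ * D)) = -Real.log δ - Real.log D := by
    rw [one_div, Real.log_inv, Real.log_mul hδ.ne' (by positivity)]; ring
  have hlδ : Real.log δ ≤ 0 := Real.log_nonpos hδ.le hδ1
  -- M contains -log D, so replacing 2 log log(1/Δ) by 2M costs 2 log D and 2 log δ; the latter
  -- cancels the -log δ of the confidence because log δ ≤ 0. The constants log 7 + 2 ≤ 4 go into 4M.
  have hΛ : Real.log (7 * (r₀ : ℝ) ^ 2 / (δ / (D : ℝ) / (K : ℝ))) ≤
      6 * M + 3 * Real.log D + Real.log K := by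
    rw [Real.log_div (by positivity) (by positivity), Real.log_mul (by norm_num) (by positivity),
      Real.log_pow, Real.log_div (by positivity) (by positivity),
      Real.log_div (by positivity) (by positivity)]
    push_cast
    linarith [log_seven_le_two]
  have hmin : ((min (K * K) (D * K) : ℕ) : ℝ) ≤ D * K := by
    exact_mod_cast min_le_right (K * K) (D * K)
  have hminlog := min_mul_log_le hK hD
  have hl := third_le_log_half hK
  have hl4 := log_le_four_mul_log_half hK
  set l := Real.log ((K : ℝ) / 2) with hldef
  set m : ℝ := ((min (K * K) (D * K) : ℕ) : ℝ) with hm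
  have hm0 : 0 ≤ m := by positivity
  have hlM : l ≤ l * M := le_mul_of_one_le_right (by linarith) hM1
  have hM3 : M ≤ 3 * (l * M) := by nlinarith
  -- The contributions are 18 from 6M ≤ 18lM, 3 · 4 from log D through `min_mul_log_le`, and 4 from
  -- log K.
  have key : m * (6 * M + 3 * Real.log D + Real.log K) ≤ D * K * (34 * (l * M)) := by
    have e1 : m * (6 * M) ≤ D * K * (18 * (l * M)) := by
      apply mul_le_mul hmin _ (by positivity) (by positivity)
      linarith
    have e2 : m * Real.log K ≤ D * K * Real.log K := by gcongr
    have e3 : (D : ℝ) * K * Real.log K ≤ D * K * (4 * (l * M)) := by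
      gcongr
      linarith
    linarith
  have hlM0 : 0 ≤ l * M := mul_nonneg (by linarith) (by linarith)
  calc m * (compareBudget (δ / (D : ℝ) / (K : ℝ)) r₀ : ℝ)
      ≤ m * (66 * 4 ^ r₀ * (6 * M + 3 * Real.log D + Real.log K)) := by
        refine mul_le_mul_of_nonneg_left (hB.trans ?_) hm0
        gcongr
    _ = 66 * 4 ^ r₀ * (m * (6 * M + 3 * Real.log D + Real.log K)) := by ring
    _ ≤ 66 * (1 / Δ ^ 2) * (D * K * (34 * (l * M))) := by gcongr
    _ = _ := by ring

/-! ### Balancing exploration and commitment -/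

/-- The order of the second term of the regret bound. -/
noncomputable def regretOrder (K D T m : ℕ) : ℝ :=
  (D : ℝ) ^ (2 / 3 : ℝ) * (K : ℝ) ^ (1 / 3 : ℝ) * (m : ℝ) ^ (1 / 3 : ℝ) * (T : ℝ) ^ (2 / 3 : ℝ) *
    Real.log ((D : ℝ) * (K : ℝ) * (T : ℝ)) ^ (1 / 3 : ℝ)

theorem mul_exploreOrder {K D T m : ℕ} (hK : 1 ≤ K) (hm : 1 ≤ m) :
    (m : ℝ) * K * exploreOrder K D T m = regretOrder K D T m := by
  have hK' : (0 : ℝ) < K := by exact_mod_cast hK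
  have hm' : (0 : ℝ) < m := by exact_mod_cast hm
  have e : ∀ x : ℝ, 0 < x → x * x ^ (-(2 / 3) : ℝ) = x ^ (1 / 3 : ℝ) := by
    intro x hx
    nth_rewrite 1 [← Real.rpow_one x]
    rw [← Real.rpow_add hx]
    norm_num
  unfold exploreOrder regretOrder
  rw [← e K hK', ← e m hm']
  ring

/-- The balance equation behind the choice of L: it says that TD sqrt(log(DKT)/g) equals the
exploration cost |A*|Kg. -/
theorem regretOrder_sq_mul_exploreOrder {K D T m : ℕ} (hK : 1 ≤ K) (hm : 1 ≤ m)
    (hl : 0 ≤ Real.log ((D : ℝ) * (K : ℝ) * (T : ℝ))) :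
    regretOrder K D T m ^ 2 * exploreOrder K D T m =
      (T : ℝ) ^ 2 * (D : ℝ) ^ 2 * Real.log ((D : ℝ) * (K : ℝ) * (T : ℝ)) := by
  have hK' : (0 : ℝ) < K := by exact_mod_cast hK
  have hm' : (0 : ℝ) < m := by exact_mod_cast hm
  have e1 : ∀ x : ℝ, 0 < x → (x ^ (-(2 / 3) : ℝ)) ^ 3 = (x ^ 2)⁻¹ := by
    intro x hx
    rw [← Real.rpow_natCast, ← Real.rpow_mul hx.le, ← Real.rpow_natCast x 2, ← Real.rpow_neg hx.le]
    norm_num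
  have e2 : ∀ x : ℝ, 0 ≤ x → (x ^ (2 / 3 : ℝ)) ^ 3 = x ^ 2 := by
    intro x hx
    rw [← Real.rpow_natCast, ← Real.rpow_mul hx, ← Real.rpow_natCast x 2]
    norm_num
  have e3 : ∀ x : ℝ, 0 ≤ x → (x ^ (1 / 3 : ℝ)) ^ 3 = x := by
    intro x hx
    rw [← Real.rpow_natCast, ← Real.rpow_mul hx]
    norm_num
  have hcube : exploreOrder K D T m ^ 3 = ((K : ℝ) ^ 2)⁻¹ * ((m : ℝ) ^ 2)⁻¹ * (D : ℝ) ^ 2 *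
      (T : ℝ) ^ 2 * Real.log ((D : ℝ) * (K : ℝ) * (T : ℝ)) := by
    unfold exploreOrder
    rw [mul_pow, mul_pow, mul_pow, mul_pow, e1 _ hK', e1 _ hm', e2 _ (by positivity),
      e2 _ (by positivity), e3 _ hl]
  rw [← mul_exploreOrder hK hm]
  calc ((m : ℝ) * K * exploreOrder K D T m) ^ 2 * exploreOrder K D T m
      = (m : ℝ) ^ 2 * K ^ 2 * exploreOrder K D T m ^ 3 := by ring
    _ = _ := by
        rw [hcube]
        field_simp

/-- The cost of committing to the estimated maximizer. -/
theorem commit_cost_le {K D T m L : ℕ} (hK : 1 ≤ K) (hm : 1 ≤ m) (hL : 0 < L) {c₁ : ℝ}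
    (hc₁ : 0 < c₁) (hl : 0 ≤ Real.log ((D : ℝ) * (K : ℝ) * (T : ℝ)))
    (h : c₁ * exploreOrder K D T m ≤ (L : ℝ)) :
    (T : ℝ) * (4 * (D * (2 * Real.sqrt (Real.log ((D : ℝ) * (K : ℝ) * (T : ℝ)) / L)))) ≤
      8 / Real.sqrt c₁ * regretOrder K D T m := by
  have hL' : (0 : ℝ) < L := by exact_mod_cast hL
  have hG : 0 ≤ regretOrder K D T m := by unfold regretOrder; positivity
  have hs : 0 < Real.sqrt c₁ := Real.sqrt_pos.2 hc₁
  set η := Real.sqrt (Real.log ((D : ℝ) * (K : ℝ) * (T : ℝ)) / L) with hη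
  have hη2 : η ^ 2 = Real.log ((D : ℝ) * (K : ℝ) * (T : ℝ)) / L := Real.sq_sqrt (by positivity)
  have key : Real.sqrt c₁ * (T * D * η) ≤ regretOrder K D T m := by
    refine le_of_sq_le_sq ?_ hG
    rw [mul_pow, Real.sq_sqrt hc₁.le, mul_pow, mul_pow, hη2, ← mul_div_assoc, ← mul_div_assoc,
      div_le_iff₀ hL', ← regretOrder_sq_mul_exploreOrder hK hm hl]
    have := mul_le_mul_of_nonneg_left h (sq_nonneg (regretOrder K D T m))
    linarith
  rw [div_mul_eq_mul_div, le_div_iff₀ hs]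
  linarith

/-- The cost of the exploration. -/
theorem explore_cost_le {K D T m L : ℕ} (hK : 1 ≤ K) (hm : 1 ≤ m) (hmD : m ≤ D) {c₂ l M Δ : ℝ}
    (hl : 1 / 3 ≤ l) (hM : 1 ≤ M) (hΔ : 0 < Δ) (hΔ2 : Δ ≤ 1 / 2)
    (h : (L : ℝ) ≤ c₂ * exploreOrder K D T m + 1) :
    (m : ℝ) * (K * L) ≤ c₂ * regretOrder K D T m + (K : ℝ) * D / Δ ^ 2 * l * M := by
  have hmD' : (m : ℝ) ≤ D := by exact_mod_cast hmD
  have h4 : 4 ≤ 1 / Δ ^ 2 := by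
    rw [le_div_iff₀ (by positivity)]
    nlinarith
  have hlM : 1 / 3 ≤ l * M := hl.trans (le_mul_of_one_le_right (by linarith) hM)
  -- Rounding L up costs at most mK ≤ DK duels, which the tournament term absorbs.
  have hone : 1 ≤ 1 / Δ ^ 2 * (l * M) := by nlinarith
  calc (m : ℝ) * (K * L) ≤ m * (K * (c₂ * exploreOrder K D T m + 1)) := by gcongr
    _ = c₂ * regretOrder K D T m + m * K := by rw [← mul_exploreOrder hK hm]; ring
    _ ≤ c₂ * regretOrder K D T m + D * K := by gcongr
    _ ≤ c₂ * regretOrder K D T m + D * K * (1 / Δ ^ 2 * (l * M)) := by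
        have := le_mul_of_one_le_right (by positivity : (0 : ℝ) ≤ D * K) hone
        linarith
    _ = _ := by ring

theorem tournament_fail_cost_le {K D T : ℕ} (hK : 1 ≤ K) (hD : 1 ≤ D) {δ : ℝ} (hδ : 0 < δ)
    (hδ1 : δ ≤ 1) : (T : ℝ) * (K * K * (D * (δ / (D : ℝ) / (K : ℝ)) ^ 2)) ≤ T * δ := by
  have hK' : (0 : ℝ) < K := by exact_mod_cast hK
  have hD' : (1 : ℝ) ≤ D := by exact_mod_cast hD
  have e : (T : ℝ) * (K * K * (D * (δ / (D : ℝ) / (K : ℝ)) ^ 2)) = T * δ * (δ / D) := by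
    field_simp
  rw [e]
  exact mul_le_of_le_one_right (by positivity) ((div_le_one (by linarith)).2 (by linarith))

/-- This radius makes exp(-2Lη²) = (DKT)⁻², so the union bound over DK estimates, times T, is
2/(DKT). -/
theorem explore_fail_cost_le {K D T L : ℕ} (hL : 0 < L) (h : 2 ≤ (D : ℝ) * K * T) :
    (T : ℝ) * exploreFail K D L (Real.sqrt (Real.log ((D : ℝ) * (K : ℝ) * (T : ℝ)) / L)) ≤ 1 := by
  have hL' : (0 : ℝ) < L := by exact_mod_cast hL
  have hl : 0 ≤ Real.log ((D : ℝ) * K * T) := Real.log_nonneg (by linarith)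
  have hη2 : -2 * (L : ℝ) * Real.sqrt (Real.log ((D : ℝ) * (K : ℝ) * (T : ℝ)) / L) ^ 2 =
      -(Real.log ((D : ℝ) * K * T) + Real.log ((D : ℝ) * K * T)) := by
    rw [Real.sq_sqrt (by positivity)]
    field_simp
    ring
  unfold exploreFail
  rw [hη2, Real.exp_neg, Real.exp_add, Real.exp_log (by linarith)]
  have e : (T : ℝ) * (D * (K * (2 * ((D : ℝ) * K * T * ((D : ℝ) * K * T))⁻¹))) =
      2 * (((D : ℝ) * K * T) * ((D : ℝ) * K * T * ((D : ℝ) * K * T))⁻¹) := by ring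
  rw [e, mul_inv, mul_inv_cancel_left₀ (by linarith), ← div_eq_mul_inv, div_le_one (by linarith)]
  exact h

end FairDuel

/-! ### Assembly of the regret bound -/

theorem theorem2 (c₁ c₂ : ℝ) (hc₁ : 0 < c₁) (hc₂ : 0 < c₂) :
    ∃ C : ℝ, 0 < C ∧
      ∀ (K D T : ℕ) [NeZero K], 3 ≤ K → 1 ≤ D → 1 ≤ T →
      ∀ (I : FairDuel.Problem K D) (aStar : Fin D → Fin K),
        (∀ d, I.IsCondorcetWinner d (aStar d)) →
      ∀ Δ : ℝ, I.IsMinGap Δ → 0 < Δ →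
      ∀ Δhat : ℝ, 0 < Δhat → Δhat < 1 →
      ∀ L : ℕ,
        c₁ * FairDuel.exploreOrder K D T (Finset.univ.image aStar).card ≤ (L : ℝ) →
        (L : ℝ) ≤ c₂ * FairDuel.exploreOrder K D T (Finset.univ.image aStar).card + 1 →
      ∀ (choices : FairDuel.Choices K D) (πStar : FairDuel.Policy K),
        (∀ π : FairDuel.Policy K,
          FairDuel.nsw π (I.score aStar) ≤ FairDuel.nsw πStar (I.score aStar)) →
        FairDuel.expectedRegret I (I.score aStar) πStar
            (FairDuel.fairETC choices (FairDuel.confParam K T Δhat) L) T ≤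
          C * ((K : ℝ) * (D : ℝ) / Δ ^ 2 * Real.log ((K : ℝ) / 2) *
                max 1 (Real.log (Real.log (1 / Δ)) +
                  Real.log (2 * Δhat * (T : ℝ) / ((K : ℝ) * (D : ℝ) * Real.log ((K : ℝ) / 2))))
              + (D : ℝ) ^ (2 / 3 : ℝ) * (K : ℝ) ^ (1 / 3 : ℝ) *
                ((Finset.univ.image aStar).card : ℝ) ^ (1 / 3 : ℝ) * (T : ℝ) ^ (2 / 3 : ℝ) *
                Real.log ((D : ℝ) * (K : ℝ) * (T : ℝ)) ^ (1 / 3 : ℝ)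
              + (K : ℝ) * Real.log ((K : ℝ) / 2) / Δhat) := by
  -- 2244 comes from the tournament, 1 from rounding L, c₂ from the exploration and 8/√c₁ from the
  -- commitment.
  refine ⟨2245 + c₂ + 8 / Real.sqrt c₁, by positivity, ?_⟩
  intro K D T _ hK hD hT I aStar hwin Δ hmin hΔ Δhat hΔhat hΔhat1 L hL1 hL2 choices πStar _
  have hK' : (3 : ℝ) ≤ K := by exact_mod_cast hK
  have hD' : (1 : ℝ) ≤ D := by exact_mod_cast hD
  have hT' : (1 : ℝ) ≤ T := by exact_mod_cast hT
  have hl := FairDuel.third_le_log_half hK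
  have hδdef : FairDuel.confParam K T Δhat =
      (K : ℝ) * Real.log ((K : ℝ) / 2) / (2 * Δhat * (T : ℝ)) := rfl
  have hDKT : 3 ≤ (D : ℝ) * K * T := by
    calc (3 : ℝ) = 1 * 3 * 1 := by norm_num
      _ ≤ (D : ℝ) * K * T := by gcongr
  have hℓ : 0 < Real.log ((D : ℝ) * (K : ℝ) * (T : ℝ)) := Real.log_pos (by linarith)
  set l := Real.log ((K : ℝ) / 2) with hldef
  have hl0 : 0 < l := by linarith
  set δ := FairDuel.confParam K T Δhat with hδ
  have hδ0 : 0 < δ := by rw [hδdef]; positivity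
  set m := (Finset.univ.image aStar).card with hm
  have hm1 : 1 ≤ m := Finset.card_pos.2 ⟨_, Finset.mem_image_of_mem _ (Finset.mem_univ ⟨0, hD⟩)⟩
  have hmD : m ≤ D := by simpa using Finset.card_image_le (s := Finset.univ) (f := aStar)
  have harg : 2 * Δhat * (T : ℝ) / ((K : ℝ) * D * l) = 1 / (δ * D) := by
    rw [hδdef]; field_simp
  rw [harg]
  have hGdef : (D : ℝ) ^ (2 / 3 : ℝ) * (K : ℝ) ^ (1 / 3 : ℝ) * (m : ℝ) ^ (1 / 3 : ℝ) *
      (T : ℝ) ^ (2 / 3 : ℝ) * Real.log ((D : ℝ) * (K : ℝ) * (T : ℝ)) ^ (1 / 3 : ℝ) =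
      FairDuel.regretOrder K D T m := rfl
  rw [hGdef]
  have hG0 : 0 ≤ FairDuel.regretOrder K D T m := by unfold FairDuel.regretOrder; positivity
  set G := FairDuel.regretOrder K D T m with hG
  set M := max 1 (Real.log (Real.log (1 / Δ)) + Real.log (1 / (δ * D))) with hM
  have hM1 : 1 ≤ M := le_max_left _ _
  set A := (K : ℝ) * D / Δ ^ 2 * l * M with hA
  have hA0 : 0 ≤ A := by positivity
  have hTδ : (T : ℝ) * δ = K * l / Δhat / 2 := by rw [hδdef]; field_simp
  set B := (K : ℝ) * l / Δhat with hB
  -- Lets B absorb the constant 1 left by the exploration failures.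
  have hB1 : 1 ≤ B := by
    rw [hB, le_div_iff₀ hΔhat]
    nlinarith
  have hs : 0 ≤ 8 / Real.sqrt c₁ := by positivity
  have hrest : ∀ x, x ≤ 2245 * A + c₂ * G + 8 / Real.sqrt c₁ * G + 2 * B →
      x ≤ (2245 + c₂ + 8 / Real.sqrt c₁) * (A + G + B) := by
    intro x hx
    refine hx.trans ?_
    have h1 : 0 ≤ (c₂ + 8 / Real.sqrt c₁) * A := by positivity
    have h2 : 0 ≤ (2243 + c₂ + 8 / Real.sqrt c₁) * B := by positivity
    linarith
  apply hrest
  have hcG : 0 ≤ c₂ * G := by positivity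
  have hsG : 0 ≤ 8 / Real.sqrt c₁ * G := by positivity
  -- For δ ≥ 1 the confidence is void, but then T ≤ Tδ = B/2 and the trivial bound suffices.
  rcases le_or_gt 1 δ with hδ1 | hδ1
  · have h1 := FairDuel.expectedRegret_le_horizon I (πStar := πStar) hwin
      (FairDuel.fairETC choices δ L) T
    have h2 : (T : ℝ) ≤ T * δ := le_mul_of_one_le_right (by linarith) hδ1
    linarith
  have hgap : ∀ d i j, i ≠ j → Δ ≤ |1 / 2 - I.P d i j| := fun d i j hij =>
    hmin.2 ⟨d, i, j, hij, rfl⟩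
  have hΔ2 : Δ ≤ 1 / 2 := by
    obtain ⟨d, i, j, -, hx⟩ := hmin.1
    rw [hx]
    have := I.P_mem d i j
    exact abs_le.2 ⟨by linarith [this.2], by linarith [this.1]⟩
  obtain ⟨r₀, hr₀, hwidth, h4, hlog⟩ := FairDuel.exists_round hΔ hΔ2
  have hg0 : 0 < FairDuel.exploreOrder K D T m := by
    have : (0 : ℝ) < m := by exact_mod_cast hm1
    unfold FairDuel.exploreOrder
    positivity
  have hL0 : (0 : ℝ) < L := lt_of_lt_of_le (by positivity) hL1
  have hL : 0 < L := by exact_mod_cast hL0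
  have hδ'0 : 0 < δ / (D : ℝ) / (K : ℝ) := by positivity
  have hδ'1 : δ / (D : ℝ) / (K : ℝ) ≤ 1 := by
    rw [div_div, div_le_one (by positivity)]
    nlinarith
  set η := Real.sqrt (Real.log ((D : ℝ) * (K : ℝ) * (T : ℝ)) / L) with hη
  have hmain := FairDuel.expectedRegret_fairETC_le I choices η (πStar := πStar) hwin hgap hwidth hr₀
    hδ'0 hδ'1 (by omega) hD hL (Real.sqrt_nonneg _) T
  have htour := FairDuel.tournament_cost_le hK hD hδ0 hδ1.le hΔ hr₀ h4 hlog
  have hcommit := FairDuel.commit_cost_le (by omega : 1 ≤ K) hm1 hL hc₁ hℓ.le hL1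
  have hexpl : (m : ℝ) * (K * L) ≤ c₂ * G + A :=
    FairDuel.explore_cost_le (by omega) hm1 hmD hl hM1 hΔ hΔ2 hL2
  have hfail1 : (T : ℝ) * (K * K * (D * (δ / (D : ℝ) / (K : ℝ)) ^ 2)) ≤ B / 2 :=
    (FairDuel.tournament_fail_cost_le (by omega) hD hδ0 hδ1.le).trans hTδ.le
  have hfail2 : (T : ℝ) * FairDuel.exploreFail K D L η ≤ 1 :=
    FairDuel.explore_fail_cost_le hL (by linarith)
  have hbudget : (FairDuel.learningBudget aStar (δ / (D : ℝ) / (K : ℝ)) L r₀ : ℝ) =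
      ((min (K * K) (D * K) : ℕ) : ℝ) *
        (FairDuel.compareBudget (δ / (D : ℝ) / (K : ℝ)) r₀ : ℝ) + m * (K * L) := by
    unfold FairDuel.learningBudget
    push_cast
    rfl
  rw [hbudget, mul_add (T : ℝ)] at hmain
  linarith
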